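/- **Robust resettable sum sketch.** In the resettable streaming model every key $x$ of a finite key set $K$ carries a value $v_x\ge 0$, initially $0$. An operation is either $\mathrm{Inc}(x,\Delta)$, which sets $v_x\leftarrow v_x+\Delta$ with real $\Delta\ge 0$, or $\mathrm{Reset}(P)$, which sets $v_x\leftarrow 0$ for all keys $x\in P\subseteq K$ (in particular single-key resets). Let $v^{(t)}_x$ be the value of $x$ after the $t$-th operation and $F_t=\sum_{x} v^{(t)}_x$. A sketch using $b$ bits of memory is a randomized streaming algorithm whose entire memory between operations is a $b$-bit string: it starts from a random string; each operation replaces the current string by a random one, using fresh coins, with a law that depends only on the current string and the operation; and the estimate $\hat F_t$ released after operation $t$ is a function of the current string. An adaptive adversary chooses each operation, possibly at random, from all previous operations and released estimates. For every integer $c\ge 0$ there is a constant $C>0$ such that the following holds for all integers $T\ge 2$, all $\varepsilon>0$ and $\delta\in(0,1/2]$, all key sets $K$ with $|K|\le T^c$ and all $\Delta_{\min}>0$. There is a sketch using $$b\;\le\; C\cdot\frac{1}{\varepsilon^{2}}\,\log^{11/2}(T)\,\log^2\!\left(\frac1\delta\right)$$ bits of memory such that, against every adaptive adversary issuing $T$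 operations all of whose nonzero increments lie in $[\Delta_{\min},\,T^c\Delta_{\min}]$, with probability at least $1-\delta$ (over the coins of the sketch and of the adversary), $$|\hat F_t-F_t|\;\le\;\varepsilon\cdot\max_{1\le t'\le t}F_{t'}\qquad\text{for all } t\in\{1,\dots,T\}.$$ -/

import Mathlib

open scoped NNReal

/-- An operation of a resettable stream over the key set `K`: `inc x Δ` increments the value of the
key `x` by `Δ ≥ 0`, and `reset P` sets to zero the value of every key that satisfies the predicate
`P` (`reset {x}` is the reset of a single key). -/
inductive StreamOp (K : Type*) where
  | inc (x : K) (Δ : ℝ≥0) : StreamOp K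
  | reset (P : Set K) : StreamOp K

namespace StreamOp

open Classical in
/-- The effect of an operation on the vector of key values. -/
noncomputable def apply {K : Type*} (v : K → ℝ≥0) : StreamOp K → K → ℝ≥0
  | inc x Δ => Function.update v x (v x + Δ)
  | reset P => fun y => if y ∈ P then 0 else v y

/-- The increments have dynamic range `r` over the smallest nonzero increment `Δmin`: every
increment is zero or lies in `[Δmin, r * Δmin]`.  Resets are not restricted. -/
def InRange {K : Type*} (Δmin r : ℝ≥0) : StreamOp K → Prop
  | inc _ Δ => Δ = 0 ∨ (Δmin ≤ Δ ∧ Δ ≤ r * Δmin)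
  | reset _ => True

/-- The key values after a sequence of operations (oldest first), starting from all zeros. -/
noncomputable def values {K : Type*} (ops : List (StreamOp K)) : K → ℝ≥0 :=
  ops.foldl apply (fun _ => 0)

/-- The sum statistic `∑ x, v x` after a sequence of operations. -/
noncomputable def sumStat {K : Type*} [Fintype K] (ops : List (StreamOp K)) : ℝ≥0 :=
  ∑ x, values ops x

end StreamOp

/-- A randomized streaming sketch whose whole memory between two operations is a string of `b` bits.
The memory is initialized at random; each operation replaces it by a random one, whose law depends
only on the current memory and on the operation; the estimate that is released after an operation is
read off the memory.  The coins of a step are fresh, so that randomness which is to be used again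
(and also the current time) has to be kept in the `b` bits. -/
structure StreamSketch (K : Type*) (b : ℕ) where
  init : PMF (Fin b → Bool)
  step : (Fin b → Bool) → StreamOp K → PMF (Fin b → Bool)
  estimate : (Fin b → Bool) → ℝ

/-- What the adversary has seen: the operations so far (oldest first), each with the estimate that
was released right after it. -/
abbrev Transcript (K : Type*) := List (StreamOp K × ℝ)

/-- An adaptive, possibly randomized adversary chooses the next operation from the transcript.  It
has no access to the memory of the sketch. -/
abbrev StreamAdversary (K : Type*) := Transcript K → PMF (StreamOp K)

/-- The joint law of the memory and of the transcript after `t` rounds of interaction. -/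
noncomputable def StreamSketch.run {K : Type*} {b : ℕ} (S : StreamSketch K b)
    (A : StreamAdversary K) : ℕ → PMF ((Fin b → Bool) × Transcript K)
  | 0 => S.init.map fun m => (m, [])
  | t + 1 => (S.run A t).bind fun p => (A p.2).bind fun op =>
      (S.step p.1 op).map fun m => (m, p.2 ++ [(op, S.estimate m)])

namespace Transcript

/-- The true value `F_t` of the sum after the first `t` operations of a transcript. -/
noncomputable def trueSum {K : Type*} [Fintype K] (h : Transcript K) (t : ℕ) : ℝ≥0 :=
  StreamOp.sumStat ((h.take t).map Prod.fst)

/-- The prefix maximum `max_{1 ≤ t' ≤ t} F_{t'}` of the sum. -/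
noncomputable def prefixMax {K : Type*} [Fintype K] (h : Transcript K) (t : ℕ) : ℝ≥0 :=
  (Finset.Icc 1 t).sup (trueSum h)

/-- Every estimate in the transcript has prefix-max error at most `ε`.  The entry of the list with
index `i` belongs to time `i + 1`. -/
def PrefixMaxAccurate {K : Type*} [Fintype K] (ε : ℝ) (h : Transcript K) : Prop :=
  ∀ (i : ℕ) (hi : i < h.length),
    |(h[i]).2 - (trueSum h (i + 1) : ℝ)| ≤ ε * (prefixMax h (i + 1) : ℝ)

end Transcript

/-- `S` is an adversarially robust sketch for the sum over `T` operations with increments of dynamic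
range `r` over `Δmin`: against every adaptive adversary that respects this range, with probability
at least `1 - δ` all `T` estimates have prefix-max error at most `ε`. -/
def StreamSketch.IsRobustSumSketch {K : Type*} [Fintype K] {b : ℕ} (S : StreamSketch K b)
    (T : ℕ) (Δmin r : ℝ≥0) (ε δ : ℝ) : Prop :=
  ∀ A : StreamAdversary K, (∀ h, ∀ op ∈ (A h).support, StreamOp.InRange Δmin r op) →
    ENNReal.ofReal (1 - δ) ≤
      (S.run A T).toOuterMeasure {p | Transcript.PrefixMaxAccurate ε p.2}

/-!
The sketch stores random samples at geometrically decreasing rates. The increments are rounded to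
units of size `Δmin / (2 * B)`; at the scale `j` every unit is sampled with probability
`2 ^ (-(j + 1))`, the sampled units of a key are kept until the key is reset, and a scale is given
up for good once its noisy sample size exceeds `B`, which bounds the memory. The estimate is the
rescaled noisy sample size of the first scale that is still in use. At that scale the prefix maximum
of the sampled sum is of order at least `B`, so that an error of order `ε * B` in the sample size is
affordable (`abs_observedEstimate_sub_le`).

An adaptive adversary could learn from exact sample sizes which units are sampled, and reset these.
Therefore only noisy sample sizes are used: at time `t` the noise is a sum of discrete Laplace
variables, one for each dyadic interval containing `t`. The sketch keeps just the current ones. If a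
unit is live during `[a, b)`, then changing whether it is sampled changes the sample sizes by one
exactly at these times. As `[a, b)` is a combination of few dyadic intervals
(`sum_intervalShift`), a translation of few noise terms hides the change
(`noisySize_add_unitShift`), and it changes the density of the noise by a factor of at most `exp s`.

The consequence for an adaptive adversary is obtained without conditional laws. The coins can be
drawn in advance (`lexp_run_machineSketch`), so the probability of an event is a sum over coins and
operations of the weight of the coins times the probability `choiceWeight` that the adversary
chooses these operations. For fixed operations, `choiceWeight` depends on the coins only through the
noisy sample sizes, hence a sampling bit has nearly its original law even when weighted by
`choiceWeight` (`tsum_bit_le`). Integrating out the bits of the live units one after the other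
bounds the weighted exponential moments of the sample size (`HiddenBits.tsum_prod_le`), and Markov's
inequality gives Gaussian tails around the mean (`HiddenBits.tsum_deviation_le`). Since the bound is
relative to the total weight of `choiceWeight`, it can be summed over all operations
(`lexp_failure_le`).

The noise terms are unbounded and are truncated in the memory. With high probability none of them is
affected, and then the truncated sketch and the one with the full noise take the same course.
-/

open scoped ENNReal

/-! ### Expectations and sums over finite product spaces -/

/-- The expectation of a nonnegative function under a probability mass function. -/
noncomputable def PMF.lexp {α : Type*} (p : PMF α) (f : α → ℝ≥0∞) : ℝ≥0∞ := ∑' a, p a * f a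

namespace PMF

variable {α β : Type*}

theorem lexp_pure (a : α) (f : α → ℝ≥0∞) : (PMF.pure a).lexp f = f a := by
  classical
  rw [lexp, tsum_eq_single a]
  · simp
  · intro b hb
    simp [hb]

theorem lexp_bind (p : PMF α) (q : α → PMF β) (f : β → ℝ≥0∞) :
    (p.bind q).lexp f = p.lexp fun a => (q a).lexp f := by
  simp only [lexp, PMF.bind_apply, ← ENNReal.tsum_mul_right, ← ENNReal.tsum_mul_left]
  rw [ENNReal.tsum_comm]
  simp only [mul_assoc]

theorem lexp_map (p : PMF α) (g : α → β) (f : β → ℝ≥0∞) :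
    (p.map g).lexp f = p.lexp fun a => f (g a) := by
  rw [PMF.map, lexp_bind]
  simp only [Function.comp, lexp_pure]

theorem toOuterMeasure_eq_lexp (p : PMF α) (s : Set α) :
    p.toOuterMeasure s = p.lexp (s.indicator 1) := by
  rw [PMF.toOuterMeasure_apply, lexp]
  refine tsum_congr fun a => ?_
  by_cases h : a ∈ s <;> simp [h]

end PMF

theorem ENNReal.tsum_fin_succ {α : Type*} {t : ℕ} (F : (Fin (t + 1) → α) → ℝ≥0∞) :
    ∑' x, F x = ∑' x : Fin t → α, ∑' a, F (Fin.snoc x a) := by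
  rw [← (Fin.snocEquiv (fun _ : Fin (t + 1) => α)).tsum_eq F, ENNReal.tsum_prod', ENNReal.tsum_comm]
  rfl

theorem ENNReal.tsum_pi_prod {ι α : Type*} [Fintype ι] (w : ι → α → ℝ≥0∞) :
    ∑' f : ι → α, ∏ i, w i (f i) = ∏ i, ∑' a, w i a := by
  have key : ∀ (t : ℕ) (w : Fin t → α → ℝ≥0∞),
      ∑' f : Fin t → α, ∏ i, w i (f i) = ∏ i, ∑' a, w i a := by
    intro t
    induction t with
    | zero => intro w; simp
    | succ t ih =>
      intro w
      rw [ENNReal.tsum_fin_succ, Fin.prod_univ_castSucc, ← ih]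
      simp only [Fin.prod_univ_castSucc, Fin.snoc_castSucc, Fin.snoc_last,
        ENNReal.tsum_mul_left, ENNReal.tsum_mul_right]
  let e := Fintype.equivFin ι
  have h := key (Fintype.card ι) (fun i => w (e.symm i))
  rw [← (Equiv.arrowCongr e (Equiv.refl α)).tsum_eq] at h
  rw [← e.symm.prod_comp (fun i => ∑' a, w i a), ← h]
  refine tsum_congr fun f => ?_
  rw [← e.symm.prod_comp]
  simp

/-- The extension of a finite sequence by a default value. -/
def extendFin {α : Type*} [Inhabited α] {t : ℕ} (x : Fin t → α) (i : ℕ) : α :=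
  if h : i < t then x ⟨i, h⟩ else default

section extendFin

variable {α : Type*} [Inhabited α] {t : ℕ}

theorem extendFin_of_lt (x : Fin t → α) {i : ℕ} (h : i < t) : extendFin x i = x ⟨i, h⟩ := by
  simp [extendFin, h]

theorem extendFin_coe (x : Fin t → α) (i : Fin t) : extendFin x i = x i :=
  extendFin_of_lt x i.2

theorem extendFin_snoc_of_lt (x : Fin t → α) (a : α) {i : ℕ} (h : i < t) :
    extendFin (Fin.snoc x a : Fin (t + 1) → α) i = extendFin x i := by
  rw [extendFin_of_lt _ (h.trans t.lt_succ_self), extendFin_of_lt _ h]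
  simp [Fin.snoc, h]

theorem extendFin_snoc_self (x : Fin t → α) (a : α) :
    extendFin (Fin.snoc x a : Fin (t + 1) → α) t = a := by
  rw [extendFin_of_lt _ t.lt_succ_self]
  simp [Fin.snoc]

end extendFin

/-! ### The interaction of a sketch with an adversary, with all coins exposed -/

instance {K : Type*} : Inhabited (StreamOp K) := ⟨.reset ∅⟩

/-- The state of a deterministic machine after `t` steps on the operations `o` with the coins
`c`. -/
def stateAfter {σ Op Ω : Type*} (upd : σ → Op → Ω → σ) (s₀ : σ) (o : ℕ → Op) (c : ℕ → Ω) : ℕ → σ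
  | 0 => s₀
  | t + 1 => upd (stateAfter upd s₀ o c t) (o t) (c t)

theorem stateAfter_congr {σ Op Ω : Type*} (upd : σ → Op → Ω → σ) (s₀ : σ) {o o' : ℕ → Op}
    {c c' : ℕ → Ω} {t : ℕ} (ho : ∀ i < t, o i = o' i) (hc : ∀ i < t, c i = c' i) :
    stateAfter upd s₀ o c t = stateAfter upd s₀ o' c' t := by
  induction t with
  | zero => rfl
  | succ t ih =>
    simp only [stateAfter]
    rw [ih (fun i hi => ho i (hi.trans t.lt_succ_self))
        (fun i hi => hc i (hi.trans t.lt_succ_self)),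
      ho t t.lt_succ_self, hc t t.lt_succ_self]

/-- The transcript of the first `t` operations of `o`, where `e i` is released after the operation
with index `i`. -/
def transcriptOf {K : Type*} (e : ℕ → ℝ) (o : ℕ → StreamOp K) (t : ℕ) : Transcript K :=
  (List.range t).map fun i => (o i, e i)

theorem transcriptOf_succ {K : Type*} (e : ℕ → ℝ) (o : ℕ → StreamOp K) (t : ℕ) :
    transcriptOf e o (t + 1) = transcriptOf e o t ++ [(o t, e t)] := by
  simp [transcriptOf, List.range_succ]

theorem transcriptOf_congr {K : Type*} {e e' : ℕ → ℝ} {o o' : ℕ → StreamOp K} {t : ℕ}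
    (ho : ∀ i < t, o i = o' i) (he : ∀ i < t, e i = e' i) :
    transcriptOf e o t = transcriptOf e' o' t := by
  refine List.map_congr_left fun i hi => ?_
  rw [List.mem_range] at hi
  rw [ho i hi, he i hi]

/-- The probability with which the adversary chooses the first `t` operations of `o` when it is
shown the estimates `e`. -/
noncomputable def choiceWeight {K : Type*} (A : StreamAdversary K) (e : ℕ → ℝ)
    (o : ℕ → StreamOp K) (t : ℕ) : ℝ≥0∞ :=
  ∏ i ∈ Finset.range t, A (transcriptOf e o i) (o i)

theorem choiceWeight_succ {K : Type*} (A : StreamAdversary K) (e : ℕ → ℝ) (o : ℕ → StreamOp K)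
    (t : ℕ) : choiceWeight A e o (t + 1) =
      choiceWeight A e o t * A (transcriptOf e o t) (o t) :=
  Finset.prod_range_succ _ _

theorem choiceWeight_congr {K : Type*} (A : StreamAdversary K) {e e' : ℕ → ℝ}
    {o o' : ℕ → StreamOp K} {t : ℕ} (ho : ∀ i < t, o i = o' i) (he : ∀ i < t, e i = e' i) :
    choiceWeight A e o t = choiceWeight A e' o' t := by
  refine Finset.prod_congr rfl fun i hi => ?_
  rw [Finset.mem_range] at hi
  rw [ho i hi, transcriptOf_congr (fun k hk => ho k (hk.trans hi)) (fun k hk => he k (hk.trans hi))]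

/-- For estimates that depend on the past only, the choices of the adversary have total
probability one. -/
theorem tsum_choiceWeight {K : Type*} (A : StreamAdversary K) (E : (ℕ → StreamOp K) → ℕ → ℝ)
    (hE : ∀ o o' i, (∀ k ≤ i, o k = o' k) → E o i = E o' i) (t : ℕ) :
    ∑' o : Fin t → StreamOp K, choiceWeight A (E (extendFin o)) (extendFin o) t = 1 := by
  induction t with
  | zero => simp [choiceWeight]
  | succ t ih =>
    rw [ENNReal.tsum_fin_succ, ← ih]
    refine tsum_congr fun o => ?_
    have h1 : ∀ a, ∀ i < t, extendFin (Fin.snoc o a : Fin (t + 1) → StreamOp K) i = extendFin o i :=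
      fun a i hi => extendFin_snoc_of_lt o a hi
    have h2 : ∀ a, ∀ i < t, E (extendFin (Fin.snoc o a : Fin (t + 1) → StreamOp K)) i
        = E (extendFin o) i :=
      fun a i hi => hE _ _ _ fun k hk => h1 a k (hk.trans_lt hi)
    have h3 : ∀ a, choiceWeight A (E (extendFin (Fin.snoc o a : Fin (t + 1) → StreamOp K)))
        (extendFin (Fin.snoc o a : Fin (t + 1) → StreamOp K)) (t + 1)
        = choiceWeight A (E (extendFin o)) (extendFin o) t *
          A (transcriptOf (E (extendFin o)) (extendFin o) t) a := by
      intro a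
      rw [choiceWeight_succ, extendFin_snoc_self,
        choiceWeight_congr A (h1 a) (h2 a), transcriptOf_congr (h1 a) (h2 a)]
    simp only [h3, ENNReal.tsum_mul_left, PMF.tsum_coe, mul_one]

section Bridge

variable {K σ Ω : Type*} {b : ℕ} [Nonempty σ]

/-- The sketch that runs a randomized state machine whose states are encoded by `enc` and whose
steps take fresh coins of law `κ`. -/
noncomputable def machineSketch (enc : σ → Fin b → Bool) (upd : σ → StreamOp K → Ω → σ) (s₀ : σ)
    (est : σ → ℝ) (κ : PMF Ω) : StreamSketch K b where
  init := PMF.pure (enc s₀)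
  step m op := κ.map fun w => enc (upd (Function.invFun enc m) op w)
  estimate m := est (Function.invFun enc m)

/-- The coins of all steps can be drawn before the interaction starts, so that the law of the
transcript is a mixture of deterministic interactions. -/
theorem lexp_run_machineSketch [Inhabited Ω] {enc : σ → Fin b → Bool}
    (henc : Function.Injective enc)
    (upd : σ → StreamOp K → Ω → σ) (s₀ : σ) (est : σ → ℝ) (κ : PMF Ω) (A : StreamAdversary K)
    (t : ℕ) (g : (Fin b → Bool) × Transcript K → ℝ≥0∞) :
    ((machineSketch enc upd s₀ est κ).run A t).lexp g =
      ∑' c : Fin t → Ω, ∑' o : Fin t → StreamOp K, (∏ i, κ (c i)) *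
        (choiceWeight A (fun i => est (stateAfter upd s₀ (extendFin o) (extendFin c) (i + 1)))
          (extendFin o) t *
        g (enc (stateAfter upd s₀ (extendFin o) (extendFin c) t),
          transcriptOf (fun i => est (stateAfter upd s₀ (extendFin o) (extendFin c) (i + 1)))
            (extendFin o) t)) := by
  induction t generalizing g with
  | zero =>
    simp [StreamSketch.run, machineSketch, PMF.lexp_map, PMF.lexp_pure, choiceWeight,
      transcriptOf, stateAfter]
  | succ t ih =>
    rw [StreamSketch.run, PMF.lexp_bind, ih, ENNReal.tsum_fin_succ]
    refine tsum_congr fun c => ?_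
    simp only [ENNReal.tsum_fin_succ (α := StreamOp K)]
    rw [ENNReal.tsum_comm]
    refine tsum_congr fun o => ?_
    rw [PMF.lexp_bind, PMF.lexp, ← ENNReal.tsum_mul_left, ← ENNReal.tsum_mul_left,
      ENNReal.tsum_comm]
    refine tsum_congr fun a => ?_
    rw [PMF.lexp_map]
    simp only [machineSketch, PMF.lexp_map]
    rw [PMF.lexp, ← ENNReal.tsum_mul_left, ← ENNReal.tsum_mul_left, ← ENNReal.tsum_mul_left]
    refine tsum_congr fun w => ?_
    have ho : ∀ i < t, extendFin (Fin.snoc o a : Fin (t + 1) → StreamOp K) i = extendFin o i :=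
      fun i hi => extendFin_snoc_of_lt o a hi
    have hc : ∀ i < t, extendFin (Fin.snoc c w : Fin (t + 1) → Ω) i = extendFin c i :=
      fun i hi => extendFin_snoc_of_lt c w hi
    have hs : ∀ i ≤ t, stateAfter upd s₀ (extendFin (Fin.snoc o a : Fin (t + 1) → StreamOp K))
        (extendFin (Fin.snoc c w : Fin (t + 1) → Ω)) i
        = stateAfter upd s₀ (extendFin o) (extendFin c) i := fun i hi =>
      stateAfter_congr _ _ (fun k hk => ho k (hk.trans_le hi)) (fun k hk => hc k (hk.trans_le hi))
    have he : ∀ i < t,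
        est (stateAfter upd s₀ (extendFin (Fin.snoc o a : Fin (t + 1) → StreamOp K))
          (extendFin (Fin.snoc c w : Fin (t + 1) → Ω)) (i + 1))
        = est (stateAfter upd s₀ (extendFin o) (extendFin c) (i + 1)) := fun i hi => by
      rw [hs (i + 1) hi]
    have hst : stateAfter upd s₀ (extendFin (Fin.snoc o a : Fin (t + 1) → StreamOp K))
        (extendFin (Fin.snoc c w : Fin (t + 1) → Ω)) (t + 1)
        = upd (stateAfter upd s₀ (extendFin o) (extendFin c) t) a w := by
      rw [stateAfter, hs t le_rfl, extendFin_snoc_self, extendFin_snoc_self]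
    have hinv : ∀ s, Function.invFun enc (enc s) = s := Function.leftInverse_invFun henc
    rw [transcriptOf_succ, transcriptOf_congr ho he, choiceWeight_succ,
      choiceWeight_congr A ho he, hst, transcriptOf_congr ho he,
      extendFin_snoc_self, Fin.prod_univ_castSucc]
    simp only [Fin.snoc_castSucc, Fin.snoc_last, hinv]
    ring

end Bridge

/-! ### The laws of the coins -/

/-- The weights of a coin that is `1` with probability `p` and `0` otherwise. -/
noncomputable def bernWeight (p : ℝ≥0∞) (z : ℤ) : ℝ≥0∞ :=
  if z = 1 then p else if z = 0 then 1 - p else 0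

theorem tsum_bernWeight {p : ℝ≥0∞} (hp : p ≤ 1) : ∑' z, bernWeight p z = 1 := by
  rw [tsum_eq_sum (s := {0, 1})]
  · simp [bernWeight, tsub_add_cancel_of_le hp]
  · intro z hz
    simp only [Finset.mem_insert, Finset.mem_singleton, not_or] at hz
    simp [bernWeight, hz.1, hz.2]

/-- The weights of the two-sided geometric (discrete Laplace) distribution with ratio `a`. -/
noncomputable def laplaceWeight (a : ℝ≥0∞) (z : ℤ) : ℝ≥0∞ :=
  a ^ z.natAbs * (∑' k : ℤ, a ^ k.natAbs)⁻¹

theorem tsum_pow_natAbs_ne_top {a : ℝ≥0∞} (ha : a < 1) : ∑' k : ℤ, a ^ k.natAbs ≠ ∞ := by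
  have h : ∑' k : ℤ, a ^ k.natAbs ≤ (1 - a)⁻¹ + (1 - a)⁻¹ := by
    rw [← ENNReal.tsum_geometric, ← Equiv.intEquivNatSumNat.symm.tsum_eq,
      ENNReal.summable.tsum_sum ENNReal.summable]
    refine add_le_add (ENNReal.tsum_le_tsum fun k => le_of_eq rfl)
      (ENNReal.tsum_le_tsum fun k => ?_)
    change a ^ (Int.negSucc k).natAbs ≤ a ^ k
    exact pow_le_pow_right_of_le_one' ha.le (by simp)
  refine ne_top_of_le_ne_top ?_ h
  simpa [tsub_eq_zero_iff_le] using ha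

theorem tsum_pow_natAbs_ne_zero (a : ℝ≥0∞) : ∑' k : ℤ, a ^ k.natAbs ≠ 0 := by
  intro h
  have := ENNReal.tsum_eq_zero.1 h 0
  simp at this

theorem tsum_laplaceWeight {a : ℝ≥0∞} (ha : a < 1) : ∑' z, laplaceWeight a z = 1 := by
  simp only [laplaceWeight, ENNReal.tsum_mul_right]
  exact ENNReal.mul_inv_cancel (tsum_pow_natAbs_ne_zero a) (tsum_pow_natAbs_ne_top ha)

/-- A translation by `d` changes the discrete Laplace weights by a factor of at most `a ^ |d|`. -/
theorem laplaceWeight_mul_le {a : ℝ≥0∞} (ha : a ≤ 1) (z d : ℤ) :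
    laplaceWeight a z * a ^ d.natAbs ≤ laplaceWeight a (z + d) := by
  rw [laplaceWeight, laplaceWeight, mul_right_comm, ← pow_add]
  gcongr ?_ * _
  exact pow_le_pow_right_of_le_one' ha (Int.natAbs_add_le z d)

theorem tsum_laplaceWeight_tail {a : ℝ≥0∞} (ha : a < 1) (m : ℕ) :
    ∑' z : ℤ, (if m < z.natAbs then laplaceWeight a z else 0) ≤ 2 * a ^ m := by
  have h1 : ∀ z : ℤ, (if m < z.natAbs then laplaceWeight a z else 0) ≤
      a ^ m * laplaceWeight a (z - m) + a ^ m * laplaceWeight a (z + m) := by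
    intro z
    split_ifs with h
    · rw [laplaceWeight, laplaceWeight, laplaceWeight, ← mul_assoc, ← mul_assoc, ← add_mul]
      gcongr
      rcases le_total 0 z with hz | hz
      · refine le_add_right ?_
        rw [← pow_add]
        exact pow_le_pow_right_of_le_one' ha.le (by omega)
      · refine le_add_left ?_
        rw [← pow_add]
        exact pow_le_pow_right_of_le_one' ha.le (by omega)
    · exact zero_le
  refine (ENNReal.tsum_le_tsum h1).trans ?_
  rw [ENNReal.tsum_add, ENNReal.tsum_mul_left, ENNReal.tsum_mul_left,
    show ∑' z : ℤ, laplaceWeight a (z - m) = _ from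
      (Equiv.subRight (m : ℤ)).tsum_eq (laplaceWeight a),
    show ∑' z : ℤ, laplaceWeight a (z + m) = _ from
      (Equiv.addRight (m : ℤ)).tsum_eq (laplaceWeight a), tsum_laplaceWeight ha, two_mul, mul_one]

/-- The effect on product weights of a translation that moves the coordinate `u` arbitrarily and
the remaining ones by a total of at most `m`, at a price of a factor `a` per unit. -/
theorem mul_prod_weight_le {I : Type*} [Fintype I] {w : I → ℤ → ℝ≥0∞}
    {a : ℝ≥0∞} (ha : a ≤ 1) (u : I) (v : I → ℤ)
    (hw : ∀ e ≠ u, ∀ z, w e z * a ^ (v e).natAbs ≤ w e (z + v e)) {m : ℕ}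
    [DecidableEq I]
    (hm : ∑ e ∈ Finset.univ.erase u, (v e).natAbs ≤ m) (z : I → ℤ) :
    w u (z u + v u) * (a ^ m * ∏ e, w e (z e)) ≤ w u (z u) * ∏ e, w e (z e + v e) := by
  rw [← Finset.mul_prod_erase _ _ (Finset.mem_univ u), ← Finset.mul_prod_erase
    _ (fun e => w e (z e + v e)) (Finset.mem_univ u)]
  have h : a ^ m * ∏ e ∈ Finset.univ.erase u, w e (z e) ≤
      ∏ e ∈ Finset.univ.erase u, w e (z e + v e) := by
    calc a ^ m * ∏ e ∈ Finset.univ.erase u, w e (z e)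
        ≤ a ^ (∑ e ∈ Finset.univ.erase u, (v e).natAbs) *
          ∏ e ∈ Finset.univ.erase u, w e (z e) := by
          gcongr ?_ * _
          exact pow_le_pow_right_of_le_one' ha hm
      _ = ∏ e ∈ Finset.univ.erase u, w e (z e) * a ^ (v e).natAbs := by
          rw [← Finset.prod_pow_eq_pow_sum, Finset.prod_mul_distrib, mul_comm]
      _ ≤ _ := by
          refine Finset.prod_le_prod' fun e he => hw e (Finset.ne_of_mem_erase he) _
  calc w u (z u + v u) * (a ^ m * (w u (z u) * ∏ e ∈ Finset.univ.erase u, w e (z e)))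
      = w u (z u) * (w u (z u + v u) * (a ^ m * ∏ e ∈ Finset.univ.erase u, w e (z e))) := by ring
    _ ≤ _ := by gcongr

/-! ### Exponential moments conditional on the released estimates -/

/-- Integrating out one hidden bit. The translation by `v` exchanges the two values of the bit
without changing the observation `H`, and changes the weights by a bounded factor, so that the
observation reveals little on the bit: its conditional odds are in the range in which `hx` bounds
the moment with the weight `x` for the value `1`. -/
theorem tsum_bit_le {G : Type*} [AddGroup G] (W H : G → ℝ≥0∞) (val : G → ℤ) (v : G)
    {p q ρ x κ : ℝ≥0∞}
    (hx : ∀ a₀ a₁ : ℝ≥0∞, p * (ρ * a₀) ≤ q * a₁ → q * (ρ * a₁) ≤ p * a₀ →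
      x * a₁ + a₀ ≤ κ * (a₀ + a₁))
    (hval : ∀ z, val (z + v) = val z + 1)
    (hsupp : ∀ z, val z ≠ 0 → val z ≠ 1 → W z = 0)
    (hW₀ : ∀ z, val z = 0 → p * (ρ * W z) ≤ q * W (z + v))
    (hW₁ : ∀ z, val z = 0 → q * (ρ * W (z + v)) ≤ p * W z)
    (hH : ∀ z, val z = 0 → H (z + v) = H z) :
    ∑' z, W z * (H z * if val z = 1 then x else 1) ≤ κ * ∑' z, W z * H z := by
  set a₀ := ∑' z, if val z = 0 then W z * H z else 0 with ha₀
  set a₁ := ∑' z, if val z = 1 then W z * H z else 0 with ha₁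
  have ha₁' : a₁ = ∑' z, if val z = 0 then W (z + v) * H z else 0 := by
    rw [ha₁, ← (Equiv.addRight v).tsum_eq]
    refine tsum_congr fun z => ?_
    simp only [Equiv.coe_addRight, hval]
    by_cases h : val z = 0
    · simp [h, hH z h]
    · have : ¬ val z + 1 = 1 := by omega
      simp [h]
  have e1 : ∑' z, W z * (H z * if val z = 1 then x else 1) = x * a₁ + a₀ := by
    rw [ha₀, ha₁, ← ENNReal.tsum_mul_left, ← ENNReal.tsum_add]
    refine tsum_congr fun z => ?_
    by_cases h1 : val z = 1
    · simp [h1]; ring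
    · by_cases h0 : val z = 0
      · simp [h0]
      · simp [h0, h1, hsupp z h0 h1]
  have e2 : ∑' z, W z * H z = a₀ + a₁ := by
    rw [ha₀, ha₁, ← ENNReal.tsum_add]
    refine tsum_congr fun z => ?_
    by_cases h1 : val z = 1
    · simp [h1]
    · by_cases h0 : val z = 0
      · simp [h0]
      · simp [h0, h1, hsupp z h0 h1]
  rw [e1, e2]
  apply hx
  · rw [ha₁', ha₀, ← ENNReal.tsum_mul_left, ← ENNReal.tsum_mul_left, ← ENNReal.tsum_mul_left]
    refine ENNReal.tsum_le_tsum fun z => ?_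
    split_ifs with h
    · calc p * (ρ * (W z * H z)) = p * (ρ * W z) * H z := by ring
        _ ≤ q * W (z + v) * H z := by gcongr ?_ * _; exact hW₀ z h
        _ = _ := by ring
    · simp
  · rw [ha₁', ha₀, ← ENNReal.tsum_mul_left, ← ENNReal.tsum_mul_left, ← ENNReal.tsum_mul_left]
    refine ENNReal.tsum_le_tsum fun z => ?_
    split_ifs with h
    · calc q * (ρ * (W (z + v) * H z)) = q * (ρ * W (z + v)) * H z := by ring
        _ ≤ p * W z * H z := by gcongr ?_ * _; exact hW₁ z h
        _ = _ := by ring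
    · simp

/-- The hidden bits `val u`, `u ∈ A`, together with translations that exchange the two values of
one bit, leave the others alone, and change the weights `W` by a bounded factor. The bits have
probabilities `p` and `q`, and `ρ ≤ 1` is the reciprocal of the factor. -/
structure HiddenBits {G Λ : Type*} [AddGroup G] (W : G → ℝ≥0∞) (A : Finset Λ) (val : Λ → G → ℤ)
    (v : Λ → G) (p q ρ : ℝ≥0∞) : Prop where
  val_add : ∀ u ∈ A, ∀ z, val u (z + v u) = val u z + 1
  val_add_of_ne : ∀ u ∈ A, ∀ u' ∈ A, u' ≠ u → ∀ z, val u' (z + v u) = val u' z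
  supp : ∀ u ∈ A, ∀ z, val u z ≠ 0 → val u z ≠ 1 → W z = 0
  le_add : ∀ u ∈ A, ∀ z, val u z = 0 → p * (ρ * W z) ≤ q * W (z + v u)
  add_le : ∀ u ∈ A, ∀ z, val u z = 0 → q * (ρ * W (z + v u)) ≤ p * W z

theorem HiddenBits.tsum_prod_le {G Λ : Type*} [AddGroup G] {W : G → ℝ≥0∞} {A : Finset Λ}
    {val : Λ → G → ℤ} {v : Λ → G} {p q ρ x κ : ℝ≥0∞} (h : HiddenBits W A val v p q ρ)
    (hx : ∀ a₀ a₁ : ℝ≥0∞, p * (ρ * a₀) ≤ q * a₁ → q * (ρ * a₁) ≤ p * a₀ →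
      x * a₁ + a₀ ≤ κ * (a₀ + a₁))
    {H : G → ℝ≥0∞} (hH : ∀ u ∈ A, ∀ z, val u z = 0 → H (z + v u) = H z) :
    ∑' z, W z * (H z * ∏ u ∈ A, if val u z = 1 then x else 1) ≤
      κ ^ A.card * ∑' z, W z * H z := by
  classical
  have key : ∀ B ⊆ A, ∑' z, W z * (H z * ∏ u ∈ B, if val u z = 1 then x else 1) ≤
      κ ^ B.card * ∑' z, W z * H z := by
    intro B
    induction B using Finset.induction_on with
    | empty => simp
    | insert u B hu ih =>
      intro hB
      have huA : u ∈ A := hB (Finset.mem_insert_self u B)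
      have hBA : B ⊆ A := fun e he => hB (Finset.mem_insert_of_mem he)
      have h1 := tsum_bit_le W (fun z => H z * ∏ u ∈ B, if val u z = 1 then x else 1) (val u) (v u)
        hx (h.val_add u huA) (h.supp u huA) (h.le_add u huA) (h.add_le u huA) (by
          intro z hz
          simp only [hH u huA z hz]
          congr 1
          refine Finset.prod_congr rfl fun e he => ?_
          rw [h.val_add_of_ne u huA e (hBA he) (fun hh => hu (hh ▸ he))])
      rw [Finset.card_insert_of_notMem hu, pow_succ']
      calc _ = ∑' z, W z * ((H z * ∏ u ∈ B, if val u z = 1 then x else 1) *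
            if val u z = 1 then x else 1) := by
            refine tsum_congr fun z => ?_
            rw [Finset.prod_insert hu]
            ring
        _ ≤ _ := h1
        _ ≤ κ * (κ ^ B.card * ∑' z, W z * H z) := by gcongr; exact ih hBA
        _ = _ := by ring
  exact key A subset_rfl

/-- The number of units in `A` whose bit is `1`. -/
def bitCount {G Λ : Type*} (A : Finset Λ) (val : Λ → G → ℤ) (z : G) : ℕ :=
  ∑ u ∈ A, if val u z = 1 then 1 else 0

theorem prod_ite_eq_pow_bitCount {G Λ : Type*} (A : Finset Λ) (val : Λ → G → ℤ) (z : G)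
    (x : ℝ≥0∞) : (∏ u ∈ A, if val u z = 1 then x else 1) = x ^ bitCount A val z := by
  rw [bitCount, ← Finset.prod_pow_eq_pow_sum]
  refine Finset.prod_congr rfl fun u _ => ?_
  split_ifs <;> simp

/-- If `a₁` and `a₀` are the weights of the values `1` and `0` of a bit, and the odds `a₁ / a₀`
exceed `p / (1 - p)` by a factor of at most `1 / ρ`, then the relative weight of `1` is at most
`p / ρ`. -/
theorem two_point_upper {p ρ x : ℝ} (hp0 : 0 < p) (hp1 : p < 1) (hρ0 : 0 < ρ) (hρ1 : ρ ≤ 1)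
    (hx : 1 ≤ x) (a₀ a₁ : ℝ≥0∞)
    (h : ENNReal.ofReal (1 - p) * (ENNReal.ofReal ρ * a₁) ≤ ENNReal.ofReal p * a₀) :
    ENNReal.ofReal x * a₁ + a₀ ≤ ENNReal.ofReal (1 + (x - 1) * p / ρ) * (a₀ + a₁) := by
  have hκ : 0 < 1 + (x - 1) * p / ρ := by
    have : 0 ≤ (x - 1) * p / ρ := div_nonneg (mul_nonneg (by linarith) hp0.le) hρ0.le
    linarith
  by_cases h0 : a₀ = ∞
  · subst h0
    simp [ENNReal.mul_top, hκ]
  by_cases h1 : a₁ = ∞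
  · subst h1
    simp [ENNReal.mul_top, hκ]
  lift a₀ to ℝ≥0 using h0
  lift a₁ to ℝ≥0 using h1
  simp only [← ENNReal.ofReal_coe_nnreal] at h ⊢
  rw [← ENNReal.ofReal_mul hρ0.le, ← ENNReal.ofReal_mul (by linarith), ← ENNReal.ofReal_mul hp0.le,
    ENNReal.ofReal_le_ofReal_iff (by positivity)] at h
  rw [← ENNReal.ofReal_add (by positivity) (by positivity), ← ENNReal.ofReal_mul (by linarith),
    ← ENNReal.ofReal_mul hκ.le, ← ENNReal.ofReal_add (by positivity) (by positivity)]
  apply ENNReal.ofReal_le_ofReal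
  have ha0 : (0 : ℝ) ≤ a₀ := a₀.2
  have ha1 : (0 : ℝ) ≤ a₁ := a₁.2
  have h2 : (a₁ : ℝ) ≤ p / ρ * (a₀ + a₁) := by
    rw [div_mul_eq_mul_div, le_div_iff₀ hρ0]
    nlinarith [mul_nonneg hp0.le ha1, mul_nonneg (mul_nonneg hp0.le ha1) (sub_nonneg.2 hρ1)]
  have h3 := mul_le_mul_of_nonneg_left h2 (sub_nonneg.2 hx)
  calc x * (a₁ : ℝ) + a₀ = (a₀ + a₁) + (x - 1) * a₁ := by ring
    _ ≤ (a₀ + a₁) + (x - 1) * (p / ρ * (a₀ + a₁)) := by linarith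
    _ = _ := by ring

/-- The counterpart of `two_point_upper` for odds that are not much smaller than `p / (1 - p)`: the
relative weight of `1` is at least `p * ρ`. -/
theorem two_point_lower {p ρ x : ℝ} (hp0 : 0 < p) (hp1 : p < 1) (hρ0 : 0 < ρ) (hρ1 : ρ ≤ 1)
    (hx0 : 0 < x) (hx : x ≤ 1) (a₀ a₁ : ℝ≥0∞)
    (h : ENNReal.ofReal p * (ENNReal.ofReal ρ * a₀) ≤ ENNReal.ofReal (1 - p) * a₁) :
    ENNReal.ofReal x * a₁ + a₀ ≤ ENNReal.ofReal (1 - (1 - x) * (p * ρ)) * (a₀ + a₁) := by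
  have hκ : 0 < 1 - (1 - x) * (p * ρ) := by
    have h1 : p * ρ < 1 := by nlinarith
    have h2 : 0 < p * ρ := by positivity
    nlinarith
  by_cases h0 : a₀ = ∞
  · subst h0
    simp only [top_add, ENNReal.mul_top (ENNReal.ofReal_pos.2 hκ).ne', le_top]
  by_cases h1 : a₁ = ∞
  · subst h1
    simp only [add_top, ENNReal.mul_top (ENNReal.ofReal_pos.2 hκ).ne', le_top]
  lift a₀ to ℝ≥0 using h0
  lift a₁ to ℝ≥0 using h1
  simp only [← ENNReal.ofReal_coe_nnreal] at h ⊢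
  rw [← ENNReal.ofReal_mul hρ0.le, ← ENNReal.ofReal_mul hp0.le, ← ENNReal.ofReal_mul (by linarith),
    ENNReal.ofReal_le_ofReal_iff (mul_nonneg (by linarith) a₁.coe_nonneg)] at h
  rw [← ENNReal.ofReal_add (by positivity) (by positivity), ← ENNReal.ofReal_mul (by linarith),
    ← ENNReal.ofReal_mul hκ.le, ← ENNReal.ofReal_add (by positivity) (by positivity)]
  apply ENNReal.ofReal_le_ofReal
  have ha0 : (0 : ℝ) ≤ a₀ := a₀.2
  have ha1 : (0 : ℝ) ≤ a₁ := a₁.2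
  have h2 : p * ρ * (a₀ + a₁) ≤ (a₁ : ℝ) := by
    nlinarith [mul_nonneg hp0.le ha1, mul_nonneg (mul_nonneg hp0.le ha1) (sub_nonneg.2 hρ1)]
  have h3 := mul_le_mul_of_nonneg_left h2 (sub_nonneg.2 hx)
  calc x * (a₁ : ℝ) + a₀ = (a₀ + a₁) - (1 - x) * a₁ := by ring
    _ ≤ (a₀ + a₁) - (1 - x) * (p * ρ * (a₀ + a₁)) := by linarith
    _ = _ := by ring

theorem HiddenBits.tsum_tail_le {G Λ : Type*} [AddGroup G] {W : G → ℝ≥0∞} {A : Finset Λ}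
    {val : Λ → G → ℤ} {v : Λ → G} {p q ρ : ℝ≥0∞} {x κ y : ℝ}
    (h : HiddenBits W A val v p q ρ) (hκ : 0 ≤ κ)
    (hx : ∀ a₀ a₁ : ℝ≥0∞, p * (ρ * a₀) ≤ q * a₁ → q * (ρ * a₁) ≤ p * a₀ →
      ENNReal.ofReal x * a₁ + a₀ ≤ ENNReal.ofReal κ * (a₀ + a₁))
    {H : G → ℝ≥0∞} (hH : ∀ u ∈ A, ∀ z, val u z = 0 → H (z + v u) = H z)
    (hx0 : 0 ≤ x) (hy : 0 ≤ y) (S : G → Prop) [DecidablePred S]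
    (hS : ∀ z, S z → 1 ≤ y * x ^ bitCount A val z) :
    ∑' z, W z * (H z * if S z then 1 else 0) ≤
      ENNReal.ofReal (y * κ ^ A.card) * ∑' z, W z * H z := by
  calc ∑' z, W z * (H z * if S z then 1 else 0)
      ≤ ∑' z, ENNReal.ofReal y *
          (W z * (H z * ∏ u ∈ A, if val u z = 1 then ENNReal.ofReal x else 1)) := by
        refine ENNReal.tsum_le_tsum fun z => ?_
        rw [prod_ite_eq_pow_bitCount]
        split_ifs with hz
        · have h1 : (1 : ℝ≥0∞) ≤ ENNReal.ofReal y * ENNReal.ofReal x ^ bitCount A val z := by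
            rw [← ENNReal.ofReal_pow hx0, ← ENNReal.ofReal_mul hy, ENNReal.one_le_ofReal]
            exact hS z hz
          calc W z * (H z * 1) ≤ W z * (H z * (ENNReal.ofReal y *
                ENNReal.ofReal x ^ bitCount A val z)) := by gcongr
            _ = _ := by ring
        · simp
    _ ≤ ENNReal.ofReal y * (ENNReal.ofReal κ ^ A.card * ∑' z, W z * H z) := by
        rw [ENNReal.tsum_mul_left]
        gcongr
        exact h.tsum_prod_le hx hH
    _ = _ := by
        rw [ENNReal.ofReal_mul hy, ENNReal.ofReal_pow hκ, mul_assoc]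

/-- Conditionally on an observation `H` that is insensitive to single bits in the sense of
`HiddenBits`, the number of ones among the hidden bits has Gaussian tails around the unconditional
mean `p * |A|`. Both the bias, by a factor `exp s` at most, and the second order terms at the
exponent `s` of the moment generating function contribute `O(s ^ 2 * M)`, which is beaten by the
`10 * s ^ 2 * M` that stems from the deviation. -/
theorem HiddenBits.tsum_deviation_le {G Λ : Type*} [AddGroup G] {W : G → ℝ≥0∞} {A : Finset Λ}
    {val : Λ → G → ℤ} {v : Λ → G} {p s M : ℝ} (hp0 : 0 < p) (hp1 : p < 1) (hs0 : 0 < s)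
    (hs1 : s ≤ 1)
    (h : HiddenBits W A val v (ENNReal.ofReal p) (ENNReal.ofReal (1 - p))
      (ENNReal.ofReal (Real.exp (-s))))
    {H : G → ℝ≥0∞} (hH : ∀ u ∈ A, ∀ z, val u z = 0 → H (z + v u) = H z)
    (hM : p * A.card ≤ M) :
    ∑' z, W z * (H z * if 10 * s * M < |(bitCount A val z : ℝ) - p * A.card| then 1 else 0) ≤
      ENNReal.ofReal (2 * Real.exp (-(5 * s ^ 2 * M))) * ∑' z, W z * H z := by
  classical
  have hM0 : 0 ≤ M := le_trans (by positivity) hM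
  have hpA : 0 ≤ p * A.card := by positivity
  have hρ1 : Real.exp (-s) ≤ 1 := Real.exp_le_one_iff.2 (by linarith)
  have hexp : Real.exp s ≤ 1 + s + s ^ 2 := by
    have := (abs_le.1 (Real.abs_exp_sub_one_sub_id_le (x := s) (by rwa [abs_of_pos hs0]))).2
    linarith
  have hexp' : 1 - s ≤ Real.exp (-s) := by
    have := Real.add_one_le_exp (-s)
    linarith
  have hexp'' : Real.exp (-s) ≤ 1 - s + s ^ 2 := by
    have := (abs_le.1 (Real.abs_exp_sub_one_sub_id_le (x := -s)
      (by rwa [abs_neg, abs_of_pos hs0]))).2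
    nlinarith
  have hup : ∑' z, W z * (H z * if 10 * s * M < (bitCount A val z : ℝ) - p * A.card then 1 else 0)
      ≤ ENNReal.ofReal (Real.exp (-(5 * s ^ 2 * M))) * ∑' z, W z * H z := by
    have hκ : 0 ≤ 1 + (Real.exp s - 1) * p / Real.exp (-s) := by
      have := Real.one_le_exp hs0.le
      have : 0 ≤ (Real.exp s - 1) * p / Real.exp (-s) :=
        div_nonneg (mul_nonneg (by linarith) hp0.le) (Real.exp_pos _).le
      linarith
    refine (h.tsum_tail_le (x := Real.exp s) (y := Real.exp (-(s * (p * A.card + 10 * s * M))))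
      hκ (fun a₀ a₁ _ h2 => two_point_upper hp0 hp1 (Real.exp_pos _) hρ1
        (Real.one_le_exp hs0.le) a₀ a₁ h2) hH (Real.exp_pos _).le (Real.exp_pos _).le _ ?_).trans ?_
    · intro z hz
      rw [← Real.exp_nat_mul, ← Real.exp_add]
      refine Real.one_le_exp ?_
      nlinarith
    · gcongr
      have h1 : (1 + (Real.exp s - 1) * p / Real.exp (-s)) ^ A.card ≤
          Real.exp (A.card * ((Real.exp s - 1) * p * Real.exp s)) := by
        rw [Real.exp_nat_mul]
        gcongr
        rw [Real.exp_neg, div_inv_eq_mul, add_comm]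
        exact Real.add_one_le_exp _
      refine (mul_le_mul_of_nonneg_left h1 (Real.exp_pos _).le).trans ?_
      rw [← Real.exp_add]
      refine Real.exp_le_exp.2 ?_
      have h2 : (Real.exp s - 1) * Real.exp s ≤ s + 5 * s ^ 2 := by
        have h3 : (Real.exp s - 1) * Real.exp s ≤ (s + s ^ 2) * (1 + s + s ^ 2) := by
          have := Real.one_le_exp hs0.le
          apply mul_le_mul <;> linarith
        have h4 : s ^ 3 ≤ s ^ 2 := pow_le_pow_of_le_one hs0.le hs1 (by norm_num)
        have h5 : s ^ 4 ≤ s ^ 2 := pow_le_pow_of_le_one hs0.le hs1 (by norm_num)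
        nlinarith
      have h6 := mul_le_mul_of_nonneg_left h2 hpA
      have h7 := mul_le_mul_of_nonneg_left hM (sq_nonneg s)
      nlinarith
  have hlo : ∑' z, W z * (H z * if 10 * s * M < p * A.card - (bitCount A val z : ℝ) then 1 else 0)
      ≤ ENNReal.ofReal (Real.exp (-(5 * s ^ 2 * M))) * ∑' z, W z * H z := by
    have hκ : 0 ≤ 1 - (1 - Real.exp (-s)) * (p * Real.exp (-s)) := by
      have h1 : p * Real.exp (-s) ≤ 1 := mul_le_one₀ hp1.le (Real.exp_pos _).le hρ1
      have h2 : 0 ≤ p * Real.exp (-s) := by positivity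
      nlinarith [Real.exp_pos (-s)]
    refine (h.tsum_tail_le (x := Real.exp (-s)) (y := Real.exp (s * (p * A.card - 10 * s * M)))
      hκ (fun a₀ a₁ h1 _ => two_point_lower hp0 hp1 (Real.exp_pos _) hρ1 (Real.exp_pos _)
        hρ1 a₀ a₁ h1) hH (Real.exp_pos _).le (Real.exp_pos _).le _ ?_).trans ?_
    · intro z hz
      rw [← Real.exp_nat_mul, ← Real.exp_add]
      refine Real.one_le_exp ?_
      nlinarith
    · gcongr
      have h1 : (1 - (1 - Real.exp (-s)) * (p * Real.exp (-s))) ^ A.card ≤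
          Real.exp (A.card * -((1 - Real.exp (-s)) * (p * Real.exp (-s)))) := by
        rw [Real.exp_nat_mul]
        gcongr
        have := Real.add_one_le_exp (-((1 - Real.exp (-s)) * (p * Real.exp (-s))))
        linarith
      refine (mul_le_mul_of_nonneg_left h1 (Real.exp_pos _).le).trans ?_
      rw [← Real.exp_add]
      refine Real.exp_le_exp.2 ?_
      have h2 : s - 2 * s ^ 2 ≤ (1 - Real.exp (-s)) * Real.exp (-s) := by
        have h3 : (s - s ^ 2) * (1 - s) ≤ (1 - Real.exp (-s)) * Real.exp (-s) := by
          apply mul_le_mul <;> linarith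
        nlinarith [pow_pos hs0 3]
      have h6 := mul_le_mul_of_nonneg_left h2 hpA
      have h7 := mul_le_mul_of_nonneg_left hM (sq_nonneg s)
      nlinarith
  calc _ ≤ ∑' z, (W z * (H z * if 10 * s * M < (bitCount A val z : ℝ) - p * A.card then 1 else 0) +
        W z * (H z * if 10 * s * M < p * A.card - (bitCount A val z : ℝ) then 1 else 0)) := by
        refine ENNReal.tsum_le_tsum fun z => ?_
        rw [← mul_add, ← mul_add]
        gcongr
        by_cases hz : 10 * s * M < |(bitCount A val z : ℝ) - p * A.card|
        · rw [if_pos hz]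
          rcases lt_abs.1 hz with h1 | h1
          · rw [if_pos h1]
            exact le_self_add
          · rw [neg_sub] at h1
            rw [if_pos h1]
            exact le_add_self
        · rw [if_neg hz]
          exact zero_le
    _ ≤ _ := by
        rw [ENNReal.tsum_add]
        refine (add_le_add hup hlo).trans_eq ?_
        rw [two_mul, ENNReal.ofReal_add (Real.exp_pos _).le (Real.exp_pos _).le, add_mul]

/-! ### Key values and the live increments -/

namespace StreamOp

variable {K R : Type*}

open Classical in
/-- The effect of an operation on key values in `R`, where an increment is by `r` instead of by its
own amount. -/
noncomputable def applyWith [AddCommMonoid R] (v : K → R) (op : StreamOp K) (r : R) : K → R :=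
  match op with
  | inc x _ => Function.update v x (v x + r)
  | reset P => fun y => if y ∈ P then 0 else v y

/-- The key values after `t` operations, where the operation with index `i` increments by `k i`. -/
noncomputable def keyValues [AddCommMonoid R] (o : ℕ → StreamOp K) (k : ℕ → R) : ℕ → K → R
  | 0 => 0
  | t + 1 => applyWith (keyValues o k t) (o t) (k t)

/-- The operation with index `τ` is an increment of `x`, and `x` is not reset afterwards by one of
the first `t` operations. -/
def LiveKey (o : ℕ → StreamOp K) (x : K) (τ t : ℕ) : Prop :=
  (∃ Δ, o τ = inc x Δ) ∧ ∀ s, τ < s → s < t → ∀ P, o s = reset P → x ∉ P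

/-- The operation with index `τ` is an increment that no reset among the first `t` operations has
undone. -/
def Live (o : ℕ → StreamOp K) (τ t : ℕ) : Prop := ∃ x, LiveKey o x τ t

open Classical in
theorem keyValues_eq_sum [AddCommMonoid R] (o : ℕ → StreamOp K) (k : ℕ → R) (t : ℕ) (x : K) :
    keyValues o k t x = ∑ τ ∈ Finset.range t, if LiveKey o x τ t then k τ else 0 := by
  induction t with
  | zero => simp [keyValues]
  | succ t ih =>
    rw [Finset.sum_range_succ, keyValues]
    have hstep : ∀ τ < t, LiveKey o x τ (t + 1) ↔
        LiveKey o x τ t ∧ ∀ P, o t = reset P → x ∉ P := by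
      intro τ hτ
      constructor
      · rintro ⟨h1, h2⟩
        exact ⟨⟨h1, fun s hs hst => h2 s hs (by omega)⟩, h2 t hτ (by omega)⟩
      · rintro ⟨⟨h1, h2⟩, h3⟩
        refine ⟨h1, fun s hs hst => ?_⟩
        rcases Nat.lt_succ_iff_lt_or_eq.1 hst with h | h
        · exact h2 s hs h
        · subst h; exact h3
    have hself : LiveKey o x t (t + 1) ↔ ∃ Δ, o t = inc x Δ :=
      ⟨fun h => h.1, fun h => ⟨h, fun s hs hst => by omega⟩⟩
    rw [if_congr hself rfl rfl, Finset.sum_congr rfl fun τ hτ =>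
      if_congr (hstep τ (Finset.mem_range.1 hτ)) rfl rfl]
    cases h : o t with
    | inc y Δ =>
      simp only [applyWith, reduceCtorEq, IsEmpty.forall_iff, implies_true, and_true]
      rw [← ih]
      by_cases hxy : x = y
      · subst hxy; simp
      · have : ¬ ∃ Δ', (inc y Δ : StreamOp K) = inc x Δ' := by
          rintro ⟨Δ', h'⟩
          injection h' with h1
          exact hxy h1.symm
        rw [Function.update_of_ne hxy, if_neg this, add_zero]
    | reset P =>
      simp only [applyWith, reduceCtorEq, exists_false, if_false, add_zero, reset.injEq,
        forall_eq']
      by_cases hx : x ∈ P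
      · simp [hx]
      · simp [hx, ih]

open Classical in
theorem sum_keyValues [Fintype K] [AddCommMonoid R] (o : ℕ → StreamOp K) (k : ℕ → R) (t : ℕ) :
    ∑ x, keyValues o k t x = ∑ τ ∈ Finset.range t, if Live o τ t then k τ else 0 := by
  simp only [keyValues_eq_sum]
  rw [Finset.sum_comm]
  refine Finset.sum_congr rfl fun τ _ => ?_
  split_ifs with h
  · obtain ⟨x, hx⟩ := h
    rw [Finset.sum_eq_single x]
    · simp [hx]
    · intro y _ hy
      rw [if_neg]
      rintro ⟨⟨Δ, h1⟩, -⟩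
      obtain ⟨⟨Δ', h2⟩, -⟩ := hx
      rw [h1] at h2
      injection h2 with h3
      exact hy h3
    · simp
  · refine Finset.sum_eq_zero fun x _ => if_neg fun hx => h ⟨x, hx⟩

theorem Live.mono {o : ℕ → StreamOp K} {τ s t : ℕ} (h : Live o τ t) (hst : s ≤ t) :
    Live o τ s := by
  obtain ⟨x, h1, h2⟩ := h
  exact ⟨x, h1, fun i hi his => h2 i hi (his.trans_le hst)⟩

/-- An increment stays live up to some time `e`, and from then on it is undone. -/
theorem exists_live_iff_lt (o : ℕ → StreamOp K) (τ T : ℕ) (hτ : τ ≤ T) :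
    ∃ e ≤ T, τ ≤ e ∧ ∀ t < T, τ ≤ t → (Live o τ (t + 1) ↔ t < e) := by
  classical
  by_cases h : ∃ t, τ ≤ t ∧ t < T ∧ ¬ Live o τ (t + 1)
  · refine ⟨Nat.find h, (Nat.find_spec h).2.1.le, (Nat.find_spec h).1, fun t ht hτt => ?_⟩
    constructor
    · intro hl
      by_contra hlt
      exact (Nat.find_spec h).2.2 (hl.mono (by omega))
    · intro hlt
      by_contra hl
      exact Nat.find_min h hlt ⟨hτt, ht, hl⟩
  · push Not at h
    exact ⟨T, le_rfl, hτ, fun t ht hτt => ⟨fun _ => ht, fun _ => h t hτt ht⟩⟩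

theorem values_append (ops : List (StreamOp K)) (op : StreamOp K) :
    values (ops ++ [op]) = apply (values ops) op := by
  simp [values]

/-- The number of whole units of size `Δmin / R` in an increment. -/
noncomputable def units (Δmin : ℝ≥0) (R : ℕ) : StreamOp K → ℕ
  | inc _ Δ => ⌊Δ * R / Δmin⌋₊
  | reset _ => 0

theorem units_le {Δmin r : ℝ≥0} (hΔ : 0 < Δmin) (R N : ℕ) (hN : r * R ≤ N) {op : StreamOp K}
    (h : InRange Δmin r op) : units Δmin R op ≤ N := by
  cases op with
  | reset P => simp [units]
  | inc x Δ =>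
    refine Nat.floor_le_of_le (le_trans ?_ hN)
    rw [div_le_iff₀ hΔ]
    rcases h with h | h
    · rw [h]; simp
    · calc Δ * R ≤ r * Δmin * R := by gcongr; exact h.2
        _ = _ := by ring

/-- Rounding the increments down to whole units changes the key values by a relative error of at
most `1 / R`. -/
theorem keyValues_units {Δmin r : ℝ≥0} (hΔ : 0 < Δmin) {R : ℕ} (hR : 0 < R)
    (o : ℕ → StreamOp K) {t : ℕ} (h : ∀ i < t, InRange Δmin r (o i)) (x : K) :
    ((keyValues o (fun i => units Δmin R (o i)) t x : ℕ) : ℝ≥0) * (Δmin / R) ≤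
        values ((List.range t).map o) x ∧
      values ((List.range t).map o) x ≤
        ((keyValues o (fun i => units Δmin R (o i)) t x : ℕ) : ℝ≥0) * (Δmin / R) * (1 + 1 / R) := by
  classical
  have hR' : (0 : ℝ≥0) < R := by exact_mod_cast hR
  induction t generalizing x with
  | zero => simp [keyValues, values]
  | succ t ih =>
    have ih := fun x => ih (fun i hi => h i (by omega)) x
    have ht := h t (by omega)
    rw [List.range_succ, List.map_append, List.map_singleton, values_append, keyValues]
    cases hop : o t with
    | reset P =>
      simp only [apply, applyWith]
      split_ifs
      · simp
      · exact ih x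
    | inc y Δ =>
      simp only [apply, applyWith, units]
      by_cases hxy : x = y
      · subst hxy
        rw [Function.update_self, Function.update_self]
        have h1 : ((⌊Δ * R / Δmin⌋₊ : ℕ) : ℝ≥0) * (Δmin / R) ≤ Δ := by
          have := Nat.floor_le (zero_le : 0 ≤ Δ * R / Δmin)
          calc ((⌊Δ * R / Δmin⌋₊ : ℕ) : ℝ≥0) * (Δmin / R) ≤ Δ * R / Δmin * (Δmin / R) := by gcongr
            _ = Δ := by field_simp
        have h2 : Δ ≤ ((⌊Δ * R / Δmin⌋₊ : ℕ) : ℝ≥0) * (Δmin / R) * (1 + 1 / R) := by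
          rw [hop] at ht
          rcases ht with h0 | ⟨h0, -⟩
          · rw [h0]; exact zero_le
          · have h3 : R ≤ ⌊Δ * R / Δmin⌋₊ := by
              refine Nat.le_floor ?_
              rw [le_div_iff₀ hΔ, mul_comm]
              gcongr
            have h3' : (R : ℝ≥0) ≤ (⌊Δ * R / Δmin⌋₊ : ℕ) := by exact_mod_cast h3
            have h4 := (Nat.lt_floor_add_one (Δ * R / Δmin)).le
            calc Δ = Δ * R / Δmin * (Δmin / R) := by field_simp
              _ ≤ ((⌊Δ * R / Δmin⌋₊ : ℕ) + 1 : ℝ≥0) * (Δmin / R) := by gcongr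
              _ ≤ ((⌊Δ * R / Δmin⌋₊ : ℕ) * (1 + 1 / R) : ℝ≥0) * (Δmin / R) := by
                  gcongr
                  rw [mul_add, mul_one]
                  gcongr
                  rw [mul_one_div, le_div_iff₀ hR']
                  simpa using h3'
              _ = _ := by ring
        push_cast
        constructor
        · rw [add_mul]
          exact add_le_add (ih x).1 h1
        · rw [add_mul, add_mul]
          exact add_le_add (ih x).2 h2
      · rw [Function.update_of_ne hxy, Function.update_of_ne hxy]
        exact ih x

end StreamOp

/-! ### Dyadic decomposition of time intervals -/

/-- An initial interval of times is the disjoint union of dyadic intervals, at most one for each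
length `2 ^ l`. -/
theorem ite_lt_eq_sum_dyadic (n : ℕ) : ∀ t b : ℕ, t < 2 ^ n → b < 2 ^ n →
    (if t < b then (1 : ℤ) else 0) =
      ∑ l : Fin n, if b / 2 ^ (l : ℕ) % 2 = 1 ∧ t / 2 ^ (l : ℕ) + 1 = b / 2 ^ (l : ℕ) then 1 else 0
    := by
  induction n with
  | zero => intro t b ht hb; simp at ht hb; simp [ht, hb]
  | succ n ih =>
    intro t b ht hb
    rw [Fin.sum_univ_succ]
    have h := ih (t / 2) (b / 2) (by omega) (by omega)
    simp only [Fin.val_succ, pow_succ', ← Nat.div_div_eq_div_mul, Fin.val_zero, pow_zero,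
      Nat.div_one]
    rw [← h]
    split_ifs <;> omega

/-- The indicator of the left end points `τ` of the dyadic interval of length `2 ^ l`, if any, in
the decomposition of the times before `b`. -/
def dyadicStart (b l τ : ℕ) : ℤ :=
  if τ % 2 ^ l = 0 ∧ b / 2 ^ l % 2 = 1 ∧ τ / 2 ^ l + 1 = b / 2 ^ l then 1 else 0

theorem sum_dyadicStart {n t b : ℕ} (ht : t < 2 ^ n) (hb : b < 2 ^ n) :
    ∑ l : Fin n, dyadicStart b l (t / 2 ^ (l : ℕ) * 2 ^ (l : ℕ)) = if t < b then 1 else 0 := by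
  rw [ite_lt_eq_sum_dyadic n t b ht hb]
  refine Finset.sum_congr rfl fun l _ => ?_
  simp [dyadicStart]

theorem sum_natAbs_dyadicStart_le (T b l : ℕ) :
    ∑ τ : Fin T, (dyadicStart b l τ).natAbs ≤ 1 := by
  have h : ∀ τ : Fin T, (dyadicStart b l τ).natAbs =
      if τ.1 % 2 ^ l = 0 ∧ b / 2 ^ l % 2 = 1 ∧ τ.1 / 2 ^ l + 1 = b / 2 ^ l then 1 else 0 := by
    intro τ
    unfold dyadicStart
    split_ifs <;> rfl
  simp only [h]
  rw [← Finset.card_filter, Finset.card_le_one]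
  intro τ hτ τ' hτ'
  simp only [Finset.mem_filter, Finset.mem_univ, true_and] at hτ hτ'
  have h1 := Nat.div_add_mod τ.1 (2 ^ l)
  have h2 := Nat.div_add_mod τ'.1 (2 ^ l)
  have h3 : τ.1 / 2 ^ l = τ'.1 / 2 ^ l := by omega
  rw [hτ.1, h3] at h1
  rw [hτ'.1] at h2
  exact Fin.ext (h1.symm.trans h2)

/-- Translating the noise terms by `intervalShift a b` lowers every partial sum at a time in
`[a, b)` by one and leaves the others alone. -/
def intervalShift (a b l τ : ℕ) : ℤ := dyadicStart a l τ - dyadicStart b l τ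

theorem sum_intervalShift {n t a b : ℕ} (ht : t < 2 ^ n) (ha : a ≤ b) (hb : b < 2 ^ n) :
    ∑ l : Fin n, intervalShift a b l (t / 2 ^ (l : ℕ) * 2 ^ (l : ℕ)) =
      -(if a ≤ t ∧ t < b then 1 else 0) := by
  simp only [intervalShift, Finset.sum_sub_distrib]
  rw [sum_dyadicStart ht hb, sum_dyadicStart ht (ha.trans_lt hb)]
  split_ifs <;> omega

theorem sum_natAbs_intervalShift_le (T n a b : ℕ) :
    ∑ τ : Fin T, ∑ l : Fin n, (intervalShift a b l τ).natAbs ≤ 2 * n := by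
  calc ∑ τ : Fin T, ∑ l : Fin n, (intervalShift a b l τ).natAbs
      ≤ ∑ τ : Fin T, ∑ l : Fin n, ((dyadicStart a l τ).natAbs + (dyadicStart b l τ).natAbs) := by
        gcongr
        exact Int.natAbs_sub_le _ _
    _ = ∑ l : Fin n, (∑ τ : Fin T, (dyadicStart a l τ).natAbs +
          ∑ τ : Fin T, (dyadicStart b l τ).natAbs) := by
        rw [Finset.sum_comm]
        simp only [Finset.sum_add_distrib]
    _ ≤ ∑ l : Fin n, (1 + 1) := by
        gcongr <;> exact sum_natAbs_dyadicStart_le _ _ _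
    _ = 2 * n := by simp [mul_comm]

/-! ### The coins of the sketch and the noisy sample sizes -/

/-- The coins of one step: at each of the `J` scales, one sampling bit for each of up to `U` units
of an increment, and fresh noise for each of the `n` lengths of dyadic intervals. -/
abbrev CoinIdx (J U n : ℕ) := Fin J × (Fin U ⊕ Fin n)

/-- The sampling probability of the scale `j`. -/
noncomputable def scaleProb (j : ℕ) : ℝ := 1 / 2 ^ (j + 1)

theorem scaleProb_pos (j : ℕ) : 0 < scaleProb j := by unfold scaleProb; positivity

theorem scaleProb_lt_one (j : ℕ) : scaleProb j < 1 := by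
  unfold scaleProb
  rw [div_lt_one (by positivity)]
  exact one_lt_pow₀ (by norm_num) (by omega)

/-- The weights of a single coin: a sampling bit, or a discrete Laplace noise with ratio `a`. -/
noncomputable def coinWeight {J U n : ℕ} (a : ℝ≥0∞) : CoinIdx J U n → ℤ → ℝ≥0∞
  | (j, .inl _) => bernWeight (ENNReal.ofReal (scaleProb j))
  | (_, .inr _) => laplaceWeight a

theorem tsum_coinWeight {J U n : ℕ} {a : ℝ≥0∞} (ha : a < 1) (i : CoinIdx J U n) :
    ∑' z, coinWeight a i z = 1 := by
  obtain ⟨j, i | l⟩ := i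
  · exact tsum_bernWeight (ENNReal.ofReal_le_one.2 (scaleProb_lt_one j).le)
  · exact tsum_laplaceWeight ha

/-- The law of the independent coins of one step. -/
noncomputable def coinLaw (J U n : ℕ) {a : ℝ≥0∞} (ha : a < 1) : PMF (CoinIdx J U n → ℤ) :=
  ⟨fun c => ∏ i, coinWeight a i (c i), by
    have h := ENNReal.tsum_pi_prod (fun i : CoinIdx J U n => coinWeight a i)
    simp only [tsum_coinWeight ha, Finset.prod_const_one] at h
    rw [← h]
    exact ENNReal.summable.hasSum⟩

theorem coinLaw_apply {J U n : ℕ} {a : ℝ≥0∞} (ha : a < 1) (c : CoinIdx J U n → ℤ) :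
    coinLaw J U n ha c = ∏ i, coinWeight a i (c i) := rfl

section Observed

variable {K : Type*} {J U n : ℕ}

/-- The number of units among the first `N` that are sampled at the scale `j`. -/
def sampledUnits (N : ℕ) (w : CoinIdx J U n → ℤ) (j : Fin J) : ℕ :=
  ∑ i : Fin U, if (i : ℕ) < N ∧ w (j, .inl i) = 1 then 1 else 0

/-- The noise at time `t`: for each length `2 ^ l`, the noise that was drawn at the left end of the
dyadic interval containing `t`. -/
def noiseSum (c : ℕ → CoinIdx J U n → ℤ) (j : Fin J) (t : ℕ) : ℤ :=
  ∑ l : Fin n, c (t / 2 ^ (l : ℕ) * 2 ^ (l : ℕ)) (j, .inr l)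

/-- The number of sampled units that are alive at the scale `j` after the operation with index `t`,
where `u op` is the number of units of `op`. -/
noncomputable def sampleSize [Fintype K] (u : StreamOp K → ℕ) (o : ℕ → StreamOp K)
    (c : ℕ → CoinIdx J U n → ℤ) (j : Fin J) (t : ℕ) : ℕ :=
  ∑ x, StreamOp.keyValues o (fun i => sampledUnits (u (o i)) (c i) j) (t + 1) x

/-- The total number of live units after the operation with index `t`. -/
noncomputable def unitSum [Fintype K] (u : StreamOp K → ℕ) (o : ℕ → StreamOp K) (t : ℕ) : ℕ :=
  ∑ x, StreamOp.keyValues o (fun i => u (o i)) (t + 1) x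

/-- The sample size at the scale `j` with its noise, which is all that the sketch reveals. -/
noncomputable def noisySize [Fintype K] (u : StreamOp K → ℕ) (o : ℕ → StreamOp K)
    (c : ℕ → CoinIdx J U n → ℤ) (j : Fin J) (t : ℕ) : ℤ :=
  sampleSize u o c j t + noiseSum c j t

variable {T : ℕ}

/-- The translation of the coins that samples, at the scale `j`, the unit `i` of the increment with
index `τ`, and that lowers the noise while this increment is live, from `τ` until `e`. -/
def unitShift (j : Fin J) (τ : Fin T) (i : Fin U) (e : ℕ) : Fin T → CoinIdx J U n → ℤ :=
  fun τ' idx => match idx with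
    | (j', .inl i') => if j' = j ∧ τ' = τ ∧ i' = i then 1 else 0
    | (j', .inr l) => if j' = j then intervalShift τ e l τ' else 0

theorem extendFin_add_apply (c v : Fin T → CoinIdx J U n → ℤ) (t : ℕ) (idx : CoinIdx J U n) :
    extendFin (c + v) t idx = extendFin c t idx + extendFin v t idx := by
  unfold extendFin
  split_ifs <;> simp

theorem sampledUnits_add_unitShift {N : ℕ} {c : Fin T → CoinIdx J U n → ℤ} {j : Fin J} {τ : Fin T}
    {i : Fin U} (e : ℕ) (hc : c τ (j, .inl i) = 0) (j' : Fin J) {t : ℕ}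
    (ht : t < T) (hi : t = τ → (i : ℕ) < N) :
    sampledUnits N (extendFin (c + unitShift j τ i e) t) j' =
      sampledUnits N (extendFin c t) j' + if j' = j ∧ t = τ then 1 else 0 := by
  unfold sampledUnits
  by_cases h : j' = j ∧ t = τ
  · obtain ⟨rfl, rfl⟩ := h
    rw [if_pos ⟨rfl, rfl⟩, ← Finset.add_sum_erase _ _ (Finset.mem_univ i),
      ← Finset.add_sum_erase (a := i) _ (fun x : Fin U => if (x : ℕ) < N ∧
        extendFin c (τ : ℕ) (j', .inl x) = 1 then 1 else 0) (Finset.mem_univ i), add_comm,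
        add_comm (ite _ _ _), add_assoc]
    congr 1
    · refine Finset.sum_congr rfl fun x hx => ?_
      have hx := Finset.ne_of_mem_erase hx
      rw [extendFin_add_apply, extendFin_coe (unitShift j' τ i e)]
      simp [unitShift, hx]
    · rw [extendFin_add_apply, extendFin_coe, extendFin_coe]
      simp [unitShift, hc, hi rfl]
  · rw [if_neg h, add_zero]
    refine Finset.sum_congr rfl fun x _ => ?_
    have h0 : extendFin (unitShift (n := n) j τ i e) t (j', .inl x) = 0 := by
      rw [extendFin_of_lt _ ht]
      have : ¬ (j' = j ∧ (⟨t, ht⟩ : Fin T) = τ ∧ x = i) := by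
        rintro ⟨h1, h2, -⟩
        exact h ⟨h1, by rw [← h2]⟩
      simp only [unitShift, if_neg this]
    rw [extendFin_add_apply, h0, add_zero]

open Classical in
/-- The hidden bit of a live unit is not visible in the noisy sample sizes: toggling it is
compensated by a translation of the noise. -/
theorem noisySize_add_unitShift [Fintype K] (u : StreamOp K → ℕ) (o : ℕ → StreamOp K)
    (hT : T < 2 ^ n) {c : Fin T → CoinIdx J U n → ℤ} {j : Fin J} {τ : Fin T} {i : Fin U} {e : ℕ}
    (heT : e ≤ T) (hτe : τ ≤ e) (he : ∀ t < T, τ ≤ t → (StreamOp.Live o τ (t + 1) ↔ t < e))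
    (hi : (i : ℕ) < u (o τ)) (hc : c τ (j, .inl i) = 0) (j' : Fin J) {t : ℕ} (ht : t < T) :
    noisySize u o (extendFin (c + unitShift j τ i e)) j' t = noisySize u o (extendFin c) j' t := by
  have h1 : sampleSize u o (extendFin (c + unitShift j τ i e)) j' t =
      sampleSize u o (extendFin c) j' t + if j' = j ∧ τ ≤ t ∧ t < e then 1 else 0 := by
    unfold sampleSize
    rw [StreamOp.sum_keyValues, StreamOp.sum_keyValues]
    have h2 : ∀ s ∈ Finset.range (t + 1), (if StreamOp.Live o s (t + 1) then
        sampledUnits (u (o s)) (extendFin (c + unitShift j τ i e) s) j' else 0) =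
        (if StreamOp.Live o s (t + 1) then sampledUnits (u (o s)) (extendFin c s) j' else 0) +
        if s = τ then (if j' = j ∧ StreamOp.Live o τ (t + 1) then 1 else 0) else 0 := by
      intro s hs
      rw [Finset.mem_range] at hs
      rw [sampledUnits_add_unitShift e hc j' (show s < T by omega) (by rintro rfl; exact hi)]
      by_cases hsτ : s = τ
      · subst hsτ
        by_cases hl : StreamOp.Live o τ (t + 1) <;> simp [hl]
      · simp [hsτ]
    rw [Finset.sum_congr rfl h2, Finset.sum_add_distrib, Finset.sum_ite_eq']
    congr 1
    by_cases hτt : (τ : ℕ) ≤ t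
    · rw [if_pos (by simpa [Nat.lt_succ_iff] using hτt)]
      simp only [he t ht hτt, hτt, true_and]
    · rw [if_neg (by simpa [Nat.lt_succ_iff] using hτt)]
      simp [hτt]
  have h2 : noiseSum (extendFin (c + unitShift j τ i e)) j' t =
      noiseSum (extendFin c) j' t - if j' = j ∧ τ ≤ t ∧ t < e then 1 else 0 := by
    unfold noiseSum
    simp only [extendFin_add_apply, Finset.sum_add_distrib]
    rw [sub_eq_add_neg]
    congr 1
    have h3 : ∀ l : Fin n, extendFin (unitShift (n := n) j τ i e) (t / 2 ^ (l : ℕ) * 2 ^ (l : ℕ))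
        (j', .inr l) = if j' = j then intervalShift τ e l (t / 2 ^ (l : ℕ) * 2 ^ (l : ℕ)) else 0 :=
      fun l => by
        rw [extendFin_of_lt _ ((Nat.div_mul_le_self _ _).trans_lt ht)]
        rfl
    simp only [h3]
    by_cases hj : j' = j
    · simp only [hj, if_true, true_and]
      exact sum_intervalShift (ht.trans hT) hτe (heT.trans_lt hT)
    · simp [hj]
  rw [noisySize, noisySize, h1, h2]
  push_cast
  split_ifs <;> omega

/-- The units that are live after the operation with index `t`. -/
noncomputable def liveUnits (u : StreamOp K → ℕ) (o : ℕ → StreamOp K) (T U t : ℕ) :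
    Finset (Fin T × Fin U) :=
  open Classical in
  Finset.univ.filter fun q => (q.1 : ℕ) ≤ t ∧ StreamOp.Live o q.1 (t + 1) ∧ (q.2 : ℕ) < u (o q.1)

/-- The time at which the increment with index `τ` is undone. -/
noncomputable def undoneAt (o : ℕ → StreamOp K) (τ : Fin T) : ℕ :=
  (StreamOp.exists_live_iff_lt o τ T τ.2.le).choose

theorem undoneAt_spec (o : ℕ → StreamOp K) (τ : Fin T) : undoneAt o τ ≤ T ∧ τ ≤ undoneAt o τ ∧
    ∀ t < T, τ ≤ t → (StreamOp.Live o τ (t + 1) ↔ t < undoneAt o τ) :=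
  (StreamOp.exists_live_iff_lt o τ T τ.2.le).choose_spec

theorem sum_liveUnits (u : StreamOp K → ℕ) (o : ℕ → StreamOp K) {t : ℕ} (ht : t < T)
    (f : ℕ → Fin U → ℕ) :
    open Classical in
    ∑ q ∈ liveUnits u o T U t, f q.1 q.2 = ∑ τ ∈ Finset.range (t + 1),
      if StreamOp.Live o τ (t + 1) then ∑ i : Fin U, if (i : ℕ) < u (o τ) then f τ i else 0 else 0
    := by
  classical
  rw [liveUnits, Finset.sum_filter, Fintype.sum_prod_type]
  have h1 : Finset.range (t + 1) = (Finset.range T).filter (· ≤ t) := by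
    ext s; simp; omega
  rw [h1, Finset.sum_filter, ← Fin.sum_univ_eq_sum_range (fun τ => if τ ≤ t then
    (if StreamOp.Live o τ (t + 1) then ∑ i : Fin U, if (i : ℕ) < u (o τ) then f τ i else 0 else 0)
    else 0)]
  refine Finset.sum_congr rfl fun τ _ => ?_
  by_cases h2 : (τ : ℕ) ≤ t <;> by_cases h3 : StreamOp.Live o τ (t + 1) <;> simp [h2, h3]

theorem bitCount_liveUnits [Fintype K] (u : StreamOp K → ℕ) (o : ℕ → StreamOp K) {t : ℕ}
    (ht : t < T) (j : Fin J) (c : Fin T → CoinIdx J U n → ℤ) :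
    bitCount (liveUnits u o T U t) (fun q c => c q.1 (j, .inl q.2)) c =
      sampleSize u o (extendFin c) j t := by
  classical
  have h := sum_liveUnits u o ht fun τ (i : Fin U) =>
    if extendFin c τ (j, .inl i) = 1 then 1 else 0
  simp only [extendFin_coe] at h
  rw [bitCount, h, sampleSize, StreamOp.sum_keyValues]
  refine Finset.sum_congr rfl fun τ _ => ?_
  simp only [sampledUnits, ite_and]

theorem card_liveUnits [Fintype K] (u : StreamOp K → ℕ) (o : ℕ → StreamOp K) {t : ℕ}
    (ht : t < T) (hU : ∀ i < T, u (o i) ≤ U) :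
    (liveUnits u o T U t).card = unitSum u o t := by
  classical
  rw [Finset.card_eq_sum_ones, sum_liveUnits u o ht fun _ _ => 1, unitSum, StreamOp.sum_keyValues]
  refine Finset.sum_congr rfl fun τ hτ => ?_
  rw [Finset.mem_range] at hτ
  rw [← Finset.card_filter, Fin.card_filter_val_lt, min_eq_right (hU τ (by omega))]

theorem hiddenBits_liveUnits (u : StreamOp K → ℕ) (o : ℕ → StreamOp K) (t : ℕ) (j : Fin J)
    {a : ℝ≥0∞} (ha : a < 1) :
    HiddenBits (fun c : Fin T → CoinIdx J U n → ℤ => ∏ t, coinLaw J U n ha (c t))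
      (liveUnits u o T U t) (fun q c => c q.1 (j, .inl q.2))
      (fun q => unitShift j q.1 q.2 (undoneAt o q.1))
      (ENNReal.ofReal (scaleProb j)) (ENNReal.ofReal (1 - scaleProb j)) (a ^ (2 * n)) := by
  classical
  have hb0 : bernWeight (ENNReal.ofReal (scaleProb j)) 0 = ENNReal.ofReal (1 - scaleProb j) := by
    rw [ENNReal.ofReal_sub _ (scaleProb_pos j).le]
    simp [bernWeight]
  have hb1 : bernWeight (ENNReal.ofReal (scaleProb j)) 1 = ENNReal.ofReal (scaleProb j) := by
    simp [bernWeight]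
  have hprod : ∀ c : Fin T → CoinIdx J U n → ℤ, ∏ t, coinLaw J U n ha (c t) =
      ∏ e : Fin T × CoinIdx J U n, coinWeight a e.2 (c e.1 e.2) := by
    intro c
    simp only [coinLaw_apply]
    exact (Fintype.prod_prod_type fun e : Fin T × CoinIdx J U n =>
      coinWeight a e.2 (c e.1 e.2)).symm
  -- The price of the translation by `unitShift`, and of its inverse (`σ = -1`).
  have hmain : ∀ (q : Fin T × Fin U) (σ : ℤ), σ.natAbs = 1 → ∀ c : Fin T → CoinIdx J U n → ℤ,
      bernWeight (ENNReal.ofReal (scaleProb j)) (c q.1 (j, .inl q.2) + σ) *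
        (a ^ (2 * n) * ∏ t, coinLaw J U n ha (c t)) ≤
      bernWeight (ENNReal.ofReal (scaleProb j)) (c q.1 (j, .inl q.2)) *
        ∏ t, coinLaw J U n ha ((c + σ • unitShift j q.1 q.2 (undoneAt o q.1) :
          Fin T → CoinIdx J U n → ℤ) t) := by
    intro q σ hσ c
    have h := mul_prod_weight_le (I := Fin T × CoinIdx J U n) (w := fun e => coinWeight a e.2)
      (a := a) ha.le (q.1, (j, .inl q.2))
      (fun e => σ * unitShift j q.1 q.2 (undoneAt o q.1) e.1 e.2) (m := 2 * n) ?_ ?_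
      (fun e => c e.1 e.2)
    · rw [hprod, hprod]
      simpa [coinWeight, unitShift] using h
    · rintro ⟨τ, j', i | l⟩ hne z
      · have : ¬ (j' = j ∧ τ = q.1 ∧ i = q.2) := by
          rintro ⟨rfl, rfl, rfl⟩
          exact hne rfl
        simp [unitShift, this]
      · exact laplaceWeight_mul_le ha.le _ _
    · calc _ ≤ ∑ e : Fin T × CoinIdx J U n, (match e.2 with
              | (_, .inl _) => 0
              | (j', .inr l) => if j' = j then
                  (intervalShift q.1 (undoneAt o q.1) l e.1).natAbs else 0) := by
            refine (Finset.sum_le_sum ?_).trans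
              (Finset.sum_le_sum_of_subset (Finset.erase_subset _ _))
            rintro ⟨τ, j', i | l⟩ he
            · have hne := Finset.ne_of_mem_erase he
              have : ¬ (j' = j ∧ τ = q.1 ∧ i = q.2) := by
                rintro ⟨rfl, rfl, rfl⟩
                exact hne rfl
              simp [unitShift, this]
            · simp only [unitShift, Int.natAbs_mul, hσ, one_mul]
              split_ifs <;> simp
        _ = ∑ τ : Fin T, ∑ l : Fin n, (intervalShift q.1 (undoneAt o q.1) l τ).natAbs := by
            rw [Fintype.sum_prod_type]
            refine Finset.sum_congr rfl fun τ _ => ?_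
            rw [Fintype.sum_prod_type]
            simp only [Fintype.sum_sum_type, Finset.sum_const_zero, zero_add]
            rw [Finset.sum_eq_single j]
            · simp
            · intro j' _ hj'
              simp [hj']
            · simp
        _ ≤ 2 * n := sum_natAbs_intervalShift_le _ _ _ _
  refine ⟨?_, ?_, ?_, ?_, ?_⟩
  · intro q _ c
    simp [unitShift]
  · intro q _ q' _ hne c
    have : ¬ (q'.1 = q.1 ∧ q'.2 = q.2) := fun h => hne (Prod.ext h.1 h.2)
    simp [unitShift, this]
  · intro q _ c h0 h1
    rw [hprod]
    refine Finset.prod_eq_zero (Finset.mem_univ (q.1, (j, .inl q.2))) ?_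
    simp [coinWeight, bernWeight, h0, h1]
  · intro q _ c hc
    have h := hmain q 1 rfl c
    rwa [hc, zero_add, hb0, hb1, one_smul] at h
  · intro q _ c hc
    have h := hmain q (-1) rfl (c + unitShift j q.1 q.2 (undoneAt o q.1))
    have h1 : (c + unitShift j q.1 q.2 (undoneAt o q.1) : Fin T → CoinIdx J U n → ℤ)
        q.1 (j, .inl q.2) = 1 := by
      simp [unitShift, hc]
    rw [h1, hb1, show (1 : ℤ) + -1 = 0 from rfl, hb0] at h
    have h2 : c + unitShift j q.1 q.2 (undoneAt o q.1) +
        (-1 : ℤ) • unitShift j q.1 q.2 (undoneAt o q.1) = c := by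
      simp
    rwa [h2] at h

end Observed

/-! ### The sketch as a state machine with bounded memory -/

/-- The value of the first alive scale, and `0` if no scale is alive. -/
noncomputable def firstEstimate {J : ℕ} (alive : Fin J → Prop) (val : Fin J → ℝ) : ℝ :=
  open Classical in
  if h : ∃ j, alive j ∧ ∀ j' < j, ¬ alive j' then val h.choose else 0

theorem firstEstimate_congr {J : ℕ} {alive alive' : Fin J → Prop} {val val' : Fin J → ℝ}
    (h : ∀ j, alive j ↔ alive' j) (hval : ∀ j, alive j → val j = val' j) :
    firstEstimate alive val = firstEstimate alive' val' := by
  obtain rfl : alive = alive' := funext fun j => propext (h j)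
  unfold firstEstimate
  split_ifs with h1
  · exact hval _ h1.choose_spec.1
  · rfl

theorem firstEstimate_eq {J : ℕ} {alive : Fin J → Prop} (val : Fin J → ℝ) (h : ∃ j, alive j) :
    ∃ j, alive j ∧ (∀ j' < j, ¬ alive j') ∧ firstEstimate alive val = val j := by
  have h1 : ∃ j, alive j ∧ ∀ j' < j, ¬ alive j' := by
    obtain ⟨j, hj, hmin⟩ := WellFounded.has_min (wellFounded_lt (α := Fin J)) {j | alive j} h
    exact ⟨j, hj, fun j' hlt hj' => hmin j' hj' hlt⟩
  exact ⟨h1.choose, h1.choose_spec.1, h1.choose_spec.2, by unfold firstEstimate; rw [dif_pos h1]⟩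

/-- A closed form of the estimate in terms of the noisy sample sizes. -/
noncomputable def observedEstimate {K : Type*} {J : ℕ} (unit : ℝ) (B : ℕ)
    (u : StreamOp K → ℕ) (o : ℕ → StreamOp K) (y : Fin J → ℕ → ℤ) (t : ℕ) : ℝ :=
  open Classical in
  if ∃ i ≤ t, u (o i) ≠ 0 then
    firstEstimate (fun j => ∀ i ≤ t, y j i ≤ B) fun j => unit / scaleProb j * (y j t : ℝ)
  else 0

theorem observedEstimate_congr {K : Type*} {J B : ℕ} {unit : ℝ} {u : StreamOp K → ℕ}
    {o o' : ℕ → StreamOp K} {y y' : Fin J → ℕ → ℤ} {t : ℕ}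
    (ho : ∀ i ≤ t, o i = o' i) (hy : ∀ j, ∀ i ≤ t, y j i = y' j i) :
    observedEstimate unit B u o y t = observedEstimate unit B u o' y' t := by
  have h1 : (∃ i ≤ t, u (o i) ≠ 0) ↔ ∃ i ≤ t, u (o' i) ≠ 0 :=
    exists_congr fun i => and_congr_right fun hi => by rw [ho i hi]
  unfold observedEstimate
  simp only [h1]
  split_ifs
  · refine firstEstimate_congr (fun j => forall₂_congr fun i hi => by rw [hy j i hi]) fun j _ => ?_
    rw [hy j t le_rfl]
  · rfl

/-- The memory of the sketch: the time, whether some increment has been nonzero, the current noise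
terms, and at each scale the sampled units of every key, or `none` once the scale has been given
up. -/
@[ext] structure SketchState (K : Type*) [Fintype K] (J n T B cap : ℕ) where
  time : Fin (T + 1)
  started : Bool
  noise : Fin J → Fin n → ℤ
  noise_le : ∀ j l, |noise j l| ≤ cap
  sample : Fin J → Option (K → ℕ)
  sample_le : ∀ j, ∀ v ∈ sample j, ∑ x, v x ≤ B + n * cap

/-- Truncation of the noise to `[-cap, cap]`. -/
def clampInt (cap : ℕ) (z : ℤ) : ℤ := max (-cap) (min z cap)

theorem abs_clampInt_le (cap : ℕ) (z : ℤ) : |clampInt cap z| ≤ cap := by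
  unfold clampInt
  rw [abs_le]
  omega

theorem clampInt_of_abs_le {cap : ℕ} {z : ℤ} (h : |z| ≤ cap) : clampInt cap z = z := by
  unfold clampInt
  rw [abs_le] at h
  omega

/-- Truncation of the noise coins only. -/
def clampCoins {J U n : ℕ} (cap : ℕ) (w : CoinIdx J U n → ℤ) : CoinIdx J U n → ℤ
  | (j, .inl i) => w (j, .inl i)
  | (j, .inr l) => clampInt cap (w (j, .inr l))

namespace SketchState

variable {K : Type*} [Fintype K] {J U n T B cap : ℕ}

/-- The noise terms after a step at time `t` with the coins `w`: the one of length `2 ^ l` is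
renewed when `t` is a multiple of `2 ^ l`. -/
def nextNoise (cap : ℕ) (noise : Fin J → Fin n → ℤ) (t : ℕ) (w : CoinIdx J U n → ℤ) (j : Fin J)
    (l : Fin n) : ℤ :=
  if t % 2 ^ (l : ℕ) = 0 then clampInt cap (w (j, .inr l)) else noise j l

/-- The initial memory. -/
def start (K : Type*) [Fintype K] (J n T B cap : ℕ) : SketchState K J n T B cap where
  time := 0
  started := false
  noise _ _ := 0
  noise_le _ _ := by simp
  sample _ := some 0
  sample_le j v hv := by
    obtain rfl : (0 : K → ℕ) = v := by simpa using hv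
    simp

theorem abs_nextNoise_le (s : SketchState K J n T B cap) (w : CoinIdx J U n → ℤ) (j : Fin J)
    (l : Fin n) : |nextNoise cap s.noise s.time w j l| ≤ cap := by
  unfold nextNoise
  split_ifs
  · exact abs_clampInt_le _ _
  · exact s.noise_le j l

open Classical in
/-- One step of the sketch. A scale whose noisy sample size exceeds `B` is given up. -/
noncomputable def next (u : StreamOp K → ℕ) (s : SketchState K J n T B cap) (op : StreamOp K)
    (w : CoinIdx J U n → ℤ) : SketchState K J n T B cap where
  time := ⟨min (s.time + 1) T, by omega⟩
  started := s.started || decide (u op ≠ 0)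
  noise := nextNoise cap s.noise s.time w
  noise_le := abs_nextNoise_le s w
  sample j := (s.sample j).bind fun v =>
    if ((∑ x, op.applyWith v (sampledUnits (u op) w j) x : ℕ) : ℤ) +
        ∑ l, nextNoise cap s.noise s.time w j l ≤ B then
      some (op.applyWith v (sampledUnits (u op) w j)) else none
  sample_le j v hv := by
    obtain ⟨v', -, h⟩ := Option.bind_eq_some_iff.1 hv
    split_ifs at h with hB
    · obtain rfl := Option.some.inj h
      have h1 : -((n * cap : ℕ) : ℤ) ≤ ∑ l, nextNoise cap s.noise s.time w j l := by
        calc -((n * cap : ℕ) : ℤ) = ∑ _l : Fin n, -(cap : ℤ) := by simp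
          _ ≤ _ := Finset.sum_le_sum fun l _ => (abs_le.1 (abs_nextNoise_le s w j l)).1
      omega

/-- The estimate that is read off the memory: the rescaled noisy sample size of the first scale that
has not been given up, and `0` as long as all increments have been zero. -/
noncomputable def estimate (unit : ℝ) (s : SketchState K J n T B cap) : ℝ :=
  if s.started then
    firstEstimate (fun j => (s.sample j).isSome) fun j =>
      unit / scaleProb j *
        (((∑ x, (s.sample j).getD 0 x : ℕ) : ℤ) + ∑ l, s.noise j l : ℤ)
  else 0

/-- The memory after `t` steps in closed form. -/
theorem stateAfter_next (u : StreamOp K → ℕ) (o : ℕ → StreamOp K) (c : ℕ → CoinIdx J U n → ℤ)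
    {t : ℕ} (ht : t ≤ T) :
    let s := stateAfter (next u) (start K J n T B cap) o c t
    (s.time : ℕ) = t ∧ (s.started = true ↔ ∃ i < t, u (o i) ≠ 0) ∧
      (∀ i, t = i + 1 → ∀ j l, s.noise j l =
        clampCoins cap (c (i / 2 ^ (l : ℕ) * 2 ^ (l : ℕ))) (j, .inr l)) ∧
      ∀ j, ((∀ i < t, noisySize u o (fun i => clampCoins cap (c i)) j i ≤ B) →
          s.sample j = some (StreamOp.keyValues o (fun i => sampledUnits (u (o i)) (c i) j) t)) ∧
        ((∃ i < t, (B : ℤ) < noisySize u o (fun i => clampCoins cap (c i)) j i) →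
          s.sample j = none) := by
  induction t with
  | zero => simp [stateAfter, start, StreamOp.keyValues]
  | succ t ih =>
    obtain ⟨ih1, ih2, ih3, ih4⟩ := ih (by omega)
    simp only at ih1 ih2 ih3 ih4 ⊢
    simp only [stateAfter]
    set s := stateAfter (next u) (start K J n T B cap) o c t
    have hnoise : ∀ j l, nextNoise cap s.noise s.time (c t) j l =
        clampCoins cap (c (t / 2 ^ (l : ℕ) * 2 ^ (l : ℕ))) (j, .inr l) := by
      intro j l
      unfold nextNoise
      rw [ih1]
      split_ifs with h
      · rw [Nat.div_mul_cancel (Nat.dvd_of_mod_eq_zero h)]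
        rfl
      · obtain ⟨i, rfl⟩ : ∃ i, t = i + 1 := by
          cases t with
          | zero => simp at h
          | succ i => exact ⟨i, rfl⟩
        rw [ih3 i rfl, Nat.succ_div, if_neg fun hd => h (Nat.mod_eq_zero_of_dvd hd), add_zero]
    have hsize : ∀ j, ((∑ x, (o t).applyWith
          (StreamOp.keyValues o (fun i => sampledUnits (u (o i)) (c i) j) t)
          (sampledUnits (u (o t)) (c t) j) x : ℕ) : ℤ) +
        ∑ l, nextNoise cap s.noise s.time (c t) j l =
        noisySize u o (fun i => clampCoins cap (c i)) j t := by
      intro j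
      rw [noisySize, sampleSize, noiseSum, Finset.sum_congr rfl fun l _ => hnoise j l]
      rfl
    refine ⟨?_, ?_, ?_, fun j => ⟨?_, ?_⟩⟩
    · simp only [next, ih1]
      omega
    · simp only [next, Bool.or_eq_true, ih2, decide_eq_true_eq, Nat.exists_lt_succ_right]
    · rintro i hi j l
      obtain rfl : t = i := by omega
      exact hnoise j l
    · intro h
      have h1 := (ih4 j).1 fun i hi => h i (by omega)
      simp only [next, h1, Option.bind_some]
      rw [hsize, if_pos (h t (by omega))]
      rfl
    · rintro ⟨i, hi, h⟩
      simp only [next]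
      by_cases h2 : ∃ i < t, (B : ℤ) < noisySize u o (fun i => clampCoins cap (c i)) j i
      · rw [(ih4 j).2 h2, Option.bind_none]
      · push Not at h2
        obtain rfl : i = t := by
          by_contra hne
          exact absurd (h2 i (by omega)) (not_le.2 h)
        rw [(ih4 j).1 h2, Option.bind_some, hsize, if_neg (not_le.2 h)]

theorem estimate_stateAfter_next (unit : ℝ) (u : StreamOp K → ℕ) (o : ℕ → StreamOp K)
    (c : ℕ → CoinIdx J U n → ℤ) {t : ℕ} (ht : t < T) :
    (stateAfter (next u) (start K J n T B cap) o c (t + 1)).estimate unit =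
      observedEstimate unit B u o (noisySize u o fun i => clampCoins cap (c i)) t := by
  obtain ⟨-, h2, h3, h4⟩ := stateAfter_next (B := B) (cap := cap) u o c (Nat.succ_le_of_lt ht)
  simp only [Nat.succ_eq_add_one, Nat.lt_succ_iff] at h2 h3 h4
  unfold estimate observedEstimate
  simp only [h2]
  split_ifs
  · refine firstEstimate_congr (fun j => ?_) fun j hj => ?_
    · constructor
      · intro hs
        by_contra hcon
        push Not at hcon
        simp [(h4 j).2 hcon] at hs
      · intro hs
        simp [(h4 j).1 hs]
    · have hs : ∀ i ≤ t, noisySize u o (fun i => clampCoins cap (c i)) j i ≤ B := by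
        by_contra hcon
        push Not at hcon
        simp [(h4 j).2 hcon] at hj
      rw [(h4 j).1 hs, noisySize, sampleSize, noiseSum,
        Finset.sum_congr rfl fun l _ => h3 t rfl j l]
      rfl
  · rfl

/-- A vector of counts of total at most `m` is determined by a list of at most `m` keys. -/
noncomputable def countsToList (m : ℕ) (v : K → ℕ) : Fin m → Option K :=
  fun i => (∑ x, v x • ({x} : Multiset K)).toList[(i : ℕ)]?

theorem countsToList_injOn {m : ℕ} {v v' : K → ℕ} (hv : ∑ x, v x ≤ m) (hv' : ∑ x, v' x ≤ m)
    (h : countsToList m v = countsToList m v') : v = v' := by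
  classical
  have hlen : ∀ v : K → ℕ, (∑ x, v x • ({x} : Multiset K)).toList.length = ∑ x, v x := by
    intro v
    simp
  have hl : (∑ x, v x • ({x} : Multiset K)).toList = (∑ x, v' x • ({x} : Multiset K)).toList := by
    refine List.ext_getElem? fun i => ?_
    by_cases hi : i < m
    · exact congrFun h ⟨i, hi⟩
    · rw [List.getElem?_eq_none (by rw [hlen]; omega), List.getElem?_eq_none (by rw [hlen]; omega)]
  have hm : ∑ x, v x • ({x} : Multiset K) = ∑ x, v' x • ({x} : Multiset K) := by
    rw [← Multiset.coe_toList (∑ x, v x • ({x} : Multiset K)), hl, Multiset.coe_toList]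
  funext x
  have := congrArg (Multiset.count x) hm
  simpa [Multiset.count_sum', Multiset.count_singleton] using this

/-- The memory fits into `b` bits. -/
theorem exists_encoding {b : ℕ} (hb : (T + 1) * (2 * (((2 * cap + 1) ^ n) ^ J *
      ((Fintype.card K + 1) ^ (B + n * cap) + 1) ^ J)) ≤ 2 ^ b) :
    ∃ enc : SketchState K J n T B cap → Fin b → Bool, Function.Injective enc := by
  classical
  let f : SketchState K J n T B cap → Fin (T + 1) × Bool × (Fin J → Fin n → Fin (2 * cap + 1)) ×
      (Fin J → Option (Fin (B + n * cap) → Option K)) := fun s =>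
    (s.time, s.started, fun j l => ⟨(s.noise j l + cap).toNat, by
      have := abs_le.1 (s.noise_le j l)
      omega⟩, fun j => (s.sample j).map (countsToList _))
  have hf : Function.Injective f := by
    intro s s' h
    simp only [f, Prod.mk.injEq] at h
    obtain ⟨h1, h2, h3, h4⟩ := h
    refine SketchState.ext h1 h2 ?_ ?_
    · funext j l
      have h5 := congrFun (congrFun h3 j) l
      simp only [Fin.mk.injEq] at h5
      have h6 := abs_le.1 (s.noise_le j l)
      have h7 := abs_le.1 (s'.noise_le j l)
      omega
    · funext j
      have h5 := congrFun h4 j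
      have h6 := s.sample_le j
      have h7 := s'.sample_le j
      generalize s.sample j = a at *
      generalize s'.sample j = a' at *
      cases a with
      | none => cases a' with
        | none => rfl
        | some v' => simp at h5
      | some v => cases a' with
        | none => simp at h5
        | some v' =>
          simp only [Option.map_some, Option.some.injEq] at h5
          rw [countsToList_injOn (h6 v rfl) (h7 v' rfl) h5]
  have hcard : Fintype.card (Fin (T + 1) × Bool × (Fin J → Fin n → Fin (2 * cap + 1)) ×
      (Fin J → Option (Fin (B + n * cap) → Option K))) ≤ Fintype.card (Fin b → Bool) := by
    simpa using hb
  obtain ⟨g⟩ := Function.Embedding.nonempty_of_card_le hcard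
  exact ⟨g ∘ f, g.injective.comp hf⟩

end SketchState

/-! ### Accuracy of the estimates -/

section Accuracy

theorem StreamOp.le_units_of_ne_zero {K : Type*} {Δmin r : ℝ≥0} (hΔ : 0 < Δmin)
    {R : ℕ} {op : StreamOp K} (h : InRange Δmin r op) (h0 : units Δmin R op ≠ 0) :
    R ≤ units Δmin R op := by
  cases op with
  | reset P => simp [units] at h0
  | inc x Δ =>
    rcases h with h | ⟨h, -⟩
    · simp [units, h] at h0
    · refine Nat.le_floor ?_
      rw [le_div_iff₀ hΔ, mul_comm]
      gcongr

variable {K : Type*} [Fintype K]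

theorem units_le_unitSum (Δmin : ℝ≥0) (R : ℕ) (o : ℕ → StreamOp K) (t : ℕ) :
    StreamOp.units Δmin R (o t) ≤ unitSum (StreamOp.units Δmin R) o t := by
  classical
  unfold unitSum
  cases h : o t with
  | reset P => simp [StreamOp.units]
  | inc x Δ =>
    refine le_trans ?_ (Finset.single_le_sum (fun _ _ => Nat.zero_le _) (Finset.mem_univ x))
    simp [StreamOp.keyValues, StreamOp.applyWith, h]

theorem sumStat_bounds {Δmin r : ℝ≥0} (hΔ : 0 < Δmin) {R : ℕ} (hR : 0 < R)
    (o : ℕ → StreamOp K) {t : ℕ} (h : ∀ i ≤ t, StreamOp.InRange Δmin r (o i)) :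
    (unitSum (StreamOp.units Δmin R) o t : ℝ) * (Δmin / R) ≤
        (StreamOp.sumStat ((List.range (t + 1)).map o) : ℝ) ∧
      (StreamOp.sumStat ((List.range (t + 1)).map o) : ℝ) ≤
        (unitSum (StreamOp.units Δmin R) o t : ℝ) * (Δmin / R) * (1 + 1 / R) := by
  have key := StreamOp.keyValues_units (r := r) hΔ hR o (t := t + 1) fun i hi => h i (by omega)
  constructor
  · have h1 : (unitSum (StreamOp.units Δmin R) o t : ℝ≥0) * (Δmin / R) ≤
        StreamOp.sumStat ((List.range (t + 1)).map o) := by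
      rw [unitSum, Nat.cast_sum, Finset.sum_mul]
      exact Finset.sum_le_sum fun x _ => (key x).1
    exact_mod_cast h1
  · have h1 : StreamOp.sumStat ((List.range (t + 1)).map o) ≤
        (unitSum (StreamOp.units Δmin R) o t : ℝ≥0) * (Δmin / R) * (1 + 1 / R) := by
      rw [unitSum, Nat.cast_sum, Finset.sum_mul, Finset.sum_mul]
      exact Finset.sum_le_sum fun x _ => (key x).2
    exact_mod_cast h1

/-- If the noise is small and the sample sizes are close to their means, then the first scale that
is still alive has a live sum of order at most `B` after sampling, whereas the prefix maximum of the
sampled sum is at least of order `B`, because the previous scale has been given up. -/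
theorem abs_observedEstimate_sub_le {J B t : ℕ} {Δmin r : ℝ≥0} (hΔ : 0 < Δmin) (hB : 0 < B)
    {s : ℝ} (hs0 : 0 < s) (hs : 24 * s ≤ 1) (hsB : 1 ≤ 24 * s * B)
    {o : ℕ → StreamOp K} (ho : ∀ i ≤ t, StreamOp.InRange Δmin r (o i))
    {y : Fin J → ℕ → ℤ} {N : Fin J → ℕ → ℕ}
    (hy : ∀ j, ∀ i ≤ t, |(y j i : ℝ) - N j i| ≤ s * B)
    (hN : ∀ (j : Fin J), ∀ i ≤ t,
      |(N j i : ℝ) - scaleProb j * unitSum (StreamOp.units Δmin (2 * B)) o i| ≤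
        s * max (B : ℝ) (scaleProb j * unitSum (StreamOp.units Δmin (2 * B)) o i))
    (htop : ∃ j : Fin J, ∀ i ≤ t,
      scaleProb j * unitSum (StreamOp.units Δmin (2 * B)) o i ≤ (B : ℝ) / 2)
    {M : ℝ} (hM : ∀ i ≤ t, (StreamOp.sumStat ((List.range (i + 1)).map o) : ℝ) ≤ M) :
    |observedEstimate (Δmin / (2 * B : ℕ) : ℝ) B (StreamOp.units Δmin (2 * B)) o y t -
      StreamOp.sumStat ((List.range (t + 1)).map o)| ≤ 24 * s * M := by
  set u := StreamOp.units (K := K) Δmin (2 * B) with hu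
  set f := unitSum u o with hf
  set unit : ℝ := Δmin / (2 * B : ℕ) with hunit
  have hR : 0 < 2 * B := by omega
  have hBr : (0 : ℝ) < B := by exact_mod_cast hB
  have hΔ' : (0 : ℝ) < Δmin := hΔ
  have hunit0 : 0 < unit := by positivity
  have hF := fun i (hi : i ≤ t) => sumStat_bounds (r := r) hΔ hR o
    fun k (hk : k ≤ i) => ho k (by omega)
  simp only [← hu, ← hf, ← hunit] at hF
  have hround : |unit * f t - StreamOp.sumStat ((List.range (t + 1)).map o)| ≤ 12 * s * M := by
    obtain ⟨h1, h2⟩ := hF t le_rfl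
    have h3 : (1 : ℝ) / (2 * B : ℕ) ≤ 12 * s := by
      rw [div_le_iff₀ (by positivity)]
      push_cast
      linarith
    have h4 : (f t : ℝ) * unit ≤ M := h1.trans (hM t le_rfl)
    have h5 : (f t : ℝ) * unit * (1 / (2 * B : ℕ)) ≤ M * (12 * s) := by
      apply mul_le_mul h4 h3 (by positivity)
      exact le_trans (by positivity) h4
    rw [abs_le]
    constructor <;> nlinarith
  unfold observedEstimate
  split_ifs with hst
  · obtain ⟨jt, hjt⟩ := htop
    have halive : ∃ j : Fin J, ∀ i ≤ t, y j i ≤ B := by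
      refine ⟨jt, fun i hi => ?_⟩
      have h1 := (abs_le.1 (hy jt i hi)).2
      have h2 := (abs_le.1 (hN jt i hi)).2
      have h3 := hjt i hi
      rw [max_eq_left (by linarith)] at h2
      have h4 : (y jt i : ℝ) ≤ (B : ℤ) := by
        push_cast
        nlinarith
      exact_mod_cast h4
    obtain ⟨j, hj, hfirst, heq⟩ := firstEstimate_eq
      (fun j : Fin J => unit / scaleProb j * (y j t : ℝ)) halive
    rw [heq]
    have hp := scaleProb_pos j
    have hjt' : (y j t : ℝ) ≤ B := by exact_mod_cast hj t le_rfl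
    have h1 := abs_le.1 (hy j t le_rfl)
    have h2 := hN j t le_rfl
    have hsmall : scaleProb j * f t ≤ 2 * B := by
      have h2 := (abs_le.1 h2).1
      by_contra hcon
      push Not at hcon
      rw [max_eq_right (by linarith)] at h2
      nlinarith
    have herr : |(y j t : ℝ) - scaleProb j * f t| ≤ 3 * s * B := by
      have h3 : max (B : ℝ) (scaleProb j * f t) ≤ 2 * B := max_le (by linarith) hsmall
      have h4 := mul_le_mul_of_nonneg_left h3 hs0.le
      have h2 := abs_le.1 h2
      rw [abs_le]
      constructor <;> linarith
    have hlarge : ∃ i ≤ t, (B : ℝ) / 4 ≤ scaleProb j * f i := by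
      rcases Nat.eq_zero_or_pos (j : ℕ) with hj0 | hj0
      · obtain ⟨i, hi, hui⟩ := hst
        refine ⟨i, hi, ?_⟩
        have h3 : 2 * B ≤ f i :=
          (StreamOp.le_units_of_ne_zero hΔ (ho i hi) hui).trans (units_le_unitSum _ _ _ _)
        have h4 : (2 * B : ℝ) ≤ f i := by exact_mod_cast h3
        rw [hj0, scaleProb]
        linarith
      · let j' : Fin J := ⟨j - 1, by omega⟩
        have h3 := hfirst j' (by rw [Fin.lt_def]; exact Nat.sub_lt hj0 one_pos)
        push Not at h3
        obtain ⟨i, hi, h3⟩ := h3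
        refine ⟨i, hi, ?_⟩
        have hpp : scaleProb j' = 2 * scaleProb j := by
          have : (j : ℕ) = (j' : ℕ) + 1 := by simp only [j']; omega
          rw [this, scaleProb, scaleProb, pow_succ _ ((j' : ℕ) + 1)]
          field_simp
        have h4 : (B : ℝ) < y j' i := by exact_mod_cast h3
        have h5 := (abs_le.1 (hy j' i hi)).2
        have h6 := (abs_le.1 (hN j' i hi)).2
        by_contra hcon
        push Not at hcon
        rw [hpp, max_eq_left (by linarith)] at h6
        nlinarith
    obtain ⟨i, hi, hlarge⟩ := hlarge
    have hBM : unit / scaleProb j * B ≤ 4 * M := by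
      have h3 := (hF i hi).1.trans (hM i hi)
      rw [div_mul_eq_mul_div, div_le_iff₀ hp]
      nlinarith
    have h5 : |unit / scaleProb j * (y j t : ℝ) - unit * f t| ≤ 12 * s * M := by
      have h6 : unit / scaleProb j * (y j t : ℝ) - unit * f t =
          unit / scaleProb j * (y j t - scaleProb j * f t) := by
        field_simp
      rw [h6, abs_mul, abs_of_pos (by positivity)]
      calc unit / scaleProb j * |(y j t : ℝ) - scaleProb j * f t|
          ≤ unit / scaleProb j * (3 * s * B) := by gcongr
        _ = 3 * s * (unit / scaleProb j * B) := by ring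
        _ ≤ 3 * s * (4 * M) := by gcongr
        _ = _ := by ring
    calc _ ≤ |unit / scaleProb j * (y j t : ℝ) - unit * f t| +
          |unit * f t - StreamOp.sumStat ((List.range (t + 1)).map o)| := abs_sub_le _ _ _
      _ ≤ _ := by linarith
  · push Not at hst
    have h0 : f t = 0 := by
      rw [hf, unitSum, StreamOp.sum_keyValues]
      refine Finset.sum_eq_zero fun τ hτ => ?_
      rw [Finset.mem_range] at hτ
      simp [hst τ (by omega)]
    obtain ⟨h1, h2⟩ := hF t le_rfl
    have h3 := hM t le_rfl
    rw [h0] at h1 h2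
    simp only [Nat.cast_zero, zero_mul] at h1 h2
    have h4 : (StreamOp.sumStat ((List.range (t + 1)).map o) : ℝ) = 0 := le_antisymm h2 h1
    rw [h4] at h3 ⊢
    simpa using by positivity

theorem trueSum_transcriptOf (e : ℕ → ℝ) (o : ℕ → StreamOp K) {T t : ℕ} (ht : t ≤ T) :
    Transcript.trueSum (transcriptOf e o T) t = StreamOp.sumStat ((List.range t).map o) := by
  rw [Transcript.trueSum, transcriptOf, ← List.map_take, List.map_map, List.take_range,
    min_eq_left ht]
  rfl

theorem prefixMaxAccurate_transcriptOf {ε : ℝ} (e : ℕ → ℝ) (o : ℕ → StreamOp K) (T : ℕ)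
    (h : ∀ t < T, ∀ M : ℝ, (∀ i ≤ t, (StreamOp.sumStat ((List.range (i + 1)).map o) : ℝ) ≤ M) →
      |e t - StreamOp.sumStat ((List.range (t + 1)).map o)| ≤ ε * M) :
    Transcript.PrefixMaxAccurate ε (transcriptOf e o T) := by
  intro t ht
  have htT : t < T := by simpa [transcriptOf] using ht
  rw [trueSum_transcriptOf e o htT]
  have he : ((transcriptOf e o T)[t]).2 = e t := by simp [transcriptOf]
  rw [he]
  refine h t htT _ fun i hi => ?_
  rw [← trueSum_transcriptOf e o (show i + 1 ≤ T by omega)]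
  exact_mod_cast Finset.le_sup (f := Transcript.trueSum (transcriptOf e o T))
    (Finset.mem_Icc.2 ⟨by omega, by omega⟩)

end Accuracy

/-! ### The failure probability -/

theorem ENNReal.tsum_pi_prod_mul {ι α : Type*} [Fintype ι] (w : ι → α → ℝ≥0∞)
    (hw : ∀ i, ∑' a, w i a = 1) (i₀ : ι) (φ : α → ℝ≥0∞) :
    ∑' f : ι → α, (∏ i, w i (f i)) * φ (f i₀) = ∑' a, w i₀ a * φ a := by
  classical
  have h := ENNReal.tsum_pi_prod fun i a => w i a * if i = i₀ then φ a else 1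
  rw [Finset.prod_eq_single i₀ (fun i _ hi => by simp [hi, hw]) (by simp)] at h
  simpa only [Finset.prod_mul_distrib, Finset.prod_ite_eq', Finset.mem_univ, if_true] using h

section Failure

variable {K : Type*} [Fintype K] {J U n T : ℕ}

theorem tsum_prod_coinLaw {a : ℝ≥0∞} (ha : a < 1) :
    ∑' c : Fin T → CoinIdx J U n → ℤ, ∏ t, coinLaw J U n ha (c t) = 1 := by
  rw [ENNReal.tsum_pi_prod fun _ => coinLaw J U n ha]
  simp [PMF.tsum_coe]

theorem tsum_large_noise_le {a : ℝ≥0∞} (ha : a < 1) (cap : ℕ) (t : Fin T) (j : Fin J) (l : Fin n) :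
    ∑' c : Fin T → CoinIdx J U n → ℤ, (∏ t, coinLaw J U n ha (c t)) *
      (if cap < (c t (j, .inr l)).natAbs then 1 else 0) ≤ 2 * a ^ cap := by
  rw [ENNReal.tsum_pi_prod_mul (fun _ => coinLaw J U n ha) (fun _ => PMF.tsum_coe _) t
    fun w => if cap < (w (j, .inr l)).natAbs then 1 else 0]
  simp only [coinLaw_apply]
  rw [ENNReal.tsum_pi_prod_mul (fun i => coinWeight a i) (tsum_coinWeight ha) (j, .inr l)
    fun z => if cap < z.natAbs then 1 else 0]
  simpa [coinWeight] using tsum_laplaceWeight_tail ha cap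

theorem tsum_exists_large_noise_le {a : ℝ≥0∞} (ha : a < 1) (cap : ℕ) :
    open Classical in
    ∑' c : Fin T → CoinIdx J U n → ℤ, (∏ t, coinLaw J U n ha (c t)) *
      (if ∃ t j l, cap < (c t (j, .inr l)).natAbs then 1 else 0) ≤
        (T * J * n : ℕ) * (2 * a ^ cap) := by
  classical
  calc _ ≤ ∑' c : Fin T → CoinIdx J U n → ℤ, ∑ q : Fin T × Fin J × Fin n,
        (∏ t, coinLaw J U n ha (c t)) *
          (if cap < (c q.1 (q.2.1, .inr q.2.2)).natAbs then 1 else 0) := by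
        refine ENNReal.tsum_le_tsum fun c => ?_
        split_ifs with h
        · obtain ⟨t, j, l, h⟩ := h
          refine le_trans ?_ (Finset.single_le_sum (fun _ _ => zero_le)
            (Finset.mem_univ ((t, j, l) : Fin T × Fin J × Fin n)))
          simp [h]
        · simp
    _ = ∑ q : Fin T × Fin J × Fin n, ∑' c : Fin T → CoinIdx J U n → ℤ,
        (∏ t, coinLaw J U n ha (c t)) *
          (if cap < (c q.1 (q.2.1, .inr q.2.2)).natAbs then 1 else 0) :=
        Summable.tsum_finsetSum fun _ _ => ENNReal.summable
    _ ≤ ∑ _q : Fin T × Fin J × Fin n, 2 * a ^ cap :=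
        Finset.sum_le_sum fun q _ => tsum_large_noise_le ha cap q.1 q.2.1 q.2.2
    _ = _ := by simp [mul_assoc]

/-- The sample size at the scale `j` and the time `t` is far from its mean. -/
def SampleDeviates (u : StreamOp K → ℕ) (s : ℝ) (B : ℕ) (o : ℕ → StreamOp K)
    (c : ℕ → CoinIdx J U n → ℤ) (j : Fin J) (t : ℕ) : Prop :=
  10 * s * max (B : ℝ) (scaleProb j * unitSum u o t) <
    |(sampleSize u o c j t : ℝ) - scaleProb j * unitSum u o t|

/-- In the interaction with truthful noise the choices of the adversary depend on the coins only
through the noisy sample sizes, so that they are independent enough of the sampling bits for the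
sample sizes to concentrate. The bound holds for each sequence of operations separately. -/
theorem tsum_choiceWeight_deviates_le (A : StreamAdversary K) (u : StreamOp K → ℕ) (unit : ℝ)
    {B : ℕ} {s : ℝ} (hs0 : 0 < s) (hs1 : s ≤ 1) {a : ℝ≥0∞} (ha : a < 1)
    (has : a ^ (2 * n) = ENNReal.ofReal (Real.exp (-s))) (hT : T < 2 ^ n)
    (o : ℕ → StreamOp K) (hU : ∀ i < T, u (o i) ≤ U) (j : Fin J) {t : ℕ} (ht : t < T) :
    open Classical in
    ∑' c : Fin T → CoinIdx J U n → ℤ, (∏ t, coinLaw J U n ha (c t)) *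
        (choiceWeight A (observedEstimate unit B u o (noisySize u o (extendFin c))) o T *
          if SampleDeviates u s B o (extendFin c) j t then 1 else 0) ≤
      ENNReal.ofReal (2 * Real.exp (-(5 * s ^ 2 * B))) *
        ∑' c : Fin T → CoinIdx J U n → ℤ, (∏ t, coinLaw J U n ha (c t)) *
          choiceWeight A (observedEstimate unit B u o (noisySize u o (extendFin c))) o T := by
  classical
  have hbits := hiddenBits_liveUnits (T := T) (U := U) (n := n) u o t j ha
  rw [has] at hbits
  have h := hbits.tsum_deviation_le (scaleProb_pos j) (scaleProb_lt_one j) hs0 hs1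
    (H := fun c => choiceWeight A (observedEstimate unit B u o (noisySize u o (extendFin c))) o T)
    (M := max (B : ℝ) (scaleProb j * unitSum u o t)) ?_ ?_
  · simp only [bitCount_liveUnits u o ht, card_liveUnits u o ht hU] at h
    refine le_trans (le_of_eq ?_) (h.trans ?_)
    · refine tsum_congr fun c => ?_
      unfold SampleDeviates
      congr
    · gcongr
      exact le_max_left _ _
  · intro q hq c hc
    simp only [liveUnits, Finset.mem_filter] at hq
    obtain ⟨h1, h2, h3⟩ := undoneAt_spec o q.1
    refine choiceWeight_congr A (fun _ _ => rfl) fun i hi => ?_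
    refine observedEstimate_congr (fun _ _ => rfl) fun j' k hk => ?_
    exact noisySize_add_unitShift u o hT h1 h2 h3 hq.2.2.2 hc j' (hk.trans_lt hi)
  · rw [card_liveUnits u o ht hU]
    exact le_max_right _ _

theorem tsum_tsum_choiceWeight (A : StreamAdversary K) (u : StreamOp K → ℕ) (unit : ℝ) (B : ℕ)
    (c : ℕ → CoinIdx J U n → ℤ) :
    ∑' o : Fin T → StreamOp K, choiceWeight A (observedEstimate unit B u (extendFin o)
      (noisySize u (extendFin o) c)) (extendFin o) T = 1 := by
  refine tsum_choiceWeight A (fun o => observedEstimate unit B u o (noisySize u o c)) ?_ T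
  intro o o' i h
  refine observedEstimate_congr h fun j k hk => ?_
  have h1 : ∀ (k : ℕ → StreamOp K → ℕ) (t : ℕ), t ≤ i + 1 →
      StreamOp.keyValues o (fun i => k i (o i)) t =
        StreamOp.keyValues o' (fun i => k i (o' i)) t := by
    intro k t
    induction t with
    | zero => intro _; rfl
    | succ t ih =>
      intro ht
      rw [StreamOp.keyValues, StreamOp.keyValues, ih (by omega), h t (by omega)]
  rw [noisySize, noisySize, sampleSize, sampleSize,
    h1 (fun i op => sampledUnits (u op) (c i) j) (k + 1) (by omega)]

/-- The probability that the sketch fails is at most the probability that some noise term is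
truncated plus the probability that some sample size deviates from its mean. -/
theorem lexp_failure_le {b B cap : ℕ} {enc : SketchState K J n T B cap → Fin b → Bool}
    [Nonempty (SketchState K J n T B cap)]
    (henc : Function.Injective enc) (A : StreamAdversary K) (u : StreamOp K → ℕ) (unit : ℝ)
    {s : ℝ} (hs0 : 0 < s) (hs1 : s ≤ 1) {a : ℝ≥0∞} (ha : a < 1)
    (has : a ^ (2 * n) = ENNReal.ofReal (Real.exp (-s))) (hT : T < 2 ^ n)
    (Ok : StreamOp K → Prop) (hA : ∀ h, ∀ op ∈ (A h).support, Ok op)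
    (hU : ∀ op, Ok op → u op ≤ U) (E : Set (Transcript K))
    (hE : ∀ (o : ℕ → StreamOp K) (c : ℕ → CoinIdx J U n → ℤ), (∀ i < T, Ok (o i)) →
      (∀ t < T, ∀ j l, |c t (j, .inr l)| ≤ cap) →
      (∀ t < T, ∀ j, ¬ SampleDeviates u s B o c j t) →
      transcriptOf (observedEstimate unit B u o (noisySize u o c)) o T ∈ E) :
    ((machineSketch enc (SketchState.next u) (SketchState.start K J n T B cap)
      (SketchState.estimate unit) (coinLaw J U n ha)).run A T).lexp
        (fun p => Eᶜ.indicator 1 p.2) ≤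
      (T * J * n : ℕ) * (2 * a ^ cap) +
        (T * J : ℕ) * ENNReal.ofReal (2 * Real.exp (-(5 * s ^ 2 * B))) := by
  classical
  rw [lexp_run_machineSketch henc]
  -- The estimates as functions of operations and coins.
  let e : (ℕ → StreamOp K) → (ℕ → CoinIdx J U n → ℤ) → ℕ → ℝ := fun o c =>
    observedEstimate unit B u o (noisySize u o c)
  let W : (Fin T → CoinIdx J U n → ℤ) → ℝ≥0∞ := fun c => ∏ t, coinLaw J U n ha (c t)
  let clamp : (Fin T → CoinIdx J U n → ℤ) → ℕ → CoinIdx J U n → ℤ := fun c i =>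
    clampCoins cap (extendFin c i)
  have hpoint : ∀ (c : Fin T → CoinIdx J U n → ℤ) (o : Fin T → StreamOp K),
      choiceWeight A (fun i => SketchState.estimate unit (stateAfter (SketchState.next u)
        (SketchState.start K J n T B cap) (extendFin o) (extendFin c) (i + 1))) (extendFin o) T *
        Eᶜ.indicator 1 (transcriptOf (fun i => SketchState.estimate unit
          (stateAfter (SketchState.next u) (SketchState.start K J n T B cap) (extendFin o)
            (extendFin c) (i + 1))) (extendFin o) T) ≤
      choiceWeight A (e (extendFin o) (clamp c)) (extendFin o) T *
          (if ∃ t j l, cap < (c t (j, .inr l)).natAbs then 1 else 0) +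
        ∑ q : Fin T × Fin J, choiceWeight A (e (extendFin o) (extendFin c)) (extendFin o) T *
          (if (∀ i < T, u (extendFin o i) ≤ U) ∧
            SampleDeviates u s B (extendFin o) (extendFin c) q.2 q.1 then 1 else 0) := by
    intro c o
    have he : ∀ i < T, SketchState.estimate unit (stateAfter (SketchState.next u)
        (SketchState.start K J n T B cap) (extendFin o) (extendFin c) (i + 1)) =
          e (extendFin o) (clamp c) i := fun i hi =>
      SketchState.estimate_stateAfter_next unit u (extendFin o) (extendFin c) hi
    rw [choiceWeight_congr A (fun _ _ => rfl) he, transcriptOf_congr (fun _ _ => rfl) he]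
    by_cases hgood : ∃ t j l, cap < (c t (j, .inr l)).natAbs
    · rw [if_pos hgood]
      refine le_add_right ?_
      gcongr
      exact Set.indicator_le_self' (fun _ _ => zero_le) _
    · have hclamp : clamp c = extendFin c := by
        funext i ⟨j, x⟩
        rcases x with x | l
        · rfl
        · refine clampInt_of_abs_le ?_
          by_cases hi : i < T
          · push Not at hgood
            rw [extendFin_of_lt _ hi]
            have := hgood ⟨i, hi⟩ j l
            rw [Int.abs_eq_natAbs]
            omega
          · simp [extendFin, hi]
      rw [if_neg hgood, mul_zero, zero_add, hclamp]
      by_cases hw : choiceWeight A (e (extendFin o) (extendFin c)) (extendFin o) T = 0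
      · simp [hw]
      have hok : ∀ i < T, Ok (extendFin o i) := fun i hi => by
        refine hA (transcriptOf (e (extendFin o) (extendFin c)) (extendFin o) i) _ ?_
        rw [PMF.mem_support_iff]
        exact (Finset.prod_ne_zero_iff.1 hw) i (Finset.mem_range.2 hi)
      by_cases hdev : ∃ q : Fin T × Fin J, SampleDeviates u s B (extendFin o) (extendFin c) q.2 q.1
      · obtain ⟨q, hq⟩ := hdev
        refine le_trans ?_ (Finset.single_le_sum (fun _ _ => zero_le) (Finset.mem_univ q))
        rw [if_pos ⟨fun i hi => hU _ (hok i hi), hq⟩]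
        gcongr
        exact Set.indicator_le_self' (fun _ _ => zero_le) _
      · rw [Set.indicator_of_notMem]
        · simp
        · rw [Set.notMem_compl_iff]
          refine hE _ _ hok (fun t ht j l => ?_) fun t ht j hd => hdev ⟨(⟨t, ht⟩, j), hd⟩
          push Not at hgood
          rw [extendFin_of_lt _ ht]
          have := hgood ⟨t, ht⟩ j l
          rw [Int.abs_eq_natAbs]
          omega
  have hsum1 : ∑' c : Fin T → CoinIdx J U n → ℤ, ∑' o : Fin T → StreamOp K, W c *
      (choiceWeight A (e (extendFin o) (clamp c)) (extendFin o) T *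
        (if ∃ t j l, cap < (c t (j, .inr l)).natAbs then 1 else 0)) ≤
      (T * J * n : ℕ) * (2 * a ^ cap) := by
    refine le_trans (le_of_eq (tsum_congr fun c => ?_)) (tsum_exists_large_noise_le ha cap)
    rw [ENNReal.tsum_mul_left, ENNReal.tsum_mul_right, tsum_tsum_choiceWeight, one_mul]
  have hsum2 : ∀ q : Fin T × Fin J, ∑' c : Fin T → CoinIdx J U n → ℤ, ∑' o : Fin T → StreamOp K,
      W c * (choiceWeight A (e (extendFin o) (extendFin c)) (extendFin o) T *
        (if (∀ i < T, u (extendFin o i) ≤ U) ∧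
          SampleDeviates u s B (extendFin o) (extendFin c) q.2 q.1 then 1 else 0)) ≤
      ENNReal.ofReal (2 * Real.exp (-(5 * s ^ 2 * B))) := by
    intro q
    rw [ENNReal.tsum_comm]
    calc _ ≤ ∑' o : Fin T → StreamOp K, ENNReal.ofReal (2 * Real.exp (-(5 * s ^ 2 * B))) *
          ∑' c, W c * choiceWeight A (e (extendFin o) (extendFin c)) (extendFin o) T := by
          refine ENNReal.tsum_le_tsum fun o => ?_
          by_cases hUo : ∀ i < T, u (extendFin o i) ≤ U
          · simp only [and_iff_right hUo]
            exact tsum_choiceWeight_deviates_le A u unit hs0 hs1 ha has hT (extendFin o) hUo q.2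
              q.1.2
          · simp [hUo]
      _ = _ := by
          rw [ENNReal.tsum_mul_left, ENNReal.tsum_comm]
          simp only [ENNReal.tsum_mul_left]
          rw [tsum_congr fun c => by rw [tsum_tsum_choiceWeight, mul_one], tsum_prod_coinLaw ha,
            mul_one]
  calc _ ≤ ∑' c : Fin T → CoinIdx J U n → ℤ, ∑' o : Fin T → StreamOp K,
        (W c * (choiceWeight A (e (extendFin o) (clamp c)) (extendFin o) T *
          (if ∃ t j l, cap < (c t (j, .inr l)).natAbs then 1 else 0)) +
        ∑ q : Fin T × Fin J, W c *
          (choiceWeight A (e (extendFin o) (extendFin c)) (extendFin o) T *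
          (if (∀ i < T, u (extendFin o i) ≤ U) ∧
            SampleDeviates u s B (extendFin o) (extendFin c) q.2 q.1 then 1 else 0))) := by
        refine ENNReal.tsum_le_tsum fun c => ENNReal.tsum_le_tsum fun o => ?_
        rw [← Finset.mul_sum, ← mul_add]
        exact mul_le_mul_right (hpoint c o) _
    _ ≤ _ := by
        simp only [ENNReal.tsum_add, Summable.tsum_finsetSum fun _ _ => ENNReal.summable]
        refine add_le_add hsum1 ?_
        calc _ ≤ ∑ _q : Fin T × Fin J, ENNReal.ofReal (2 * Real.exp (-(5 * s ^ 2 * B))) :=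
              Finset.sum_le_sum fun q _ => hsum2 q
          _ = _ := by simp

end Failure

/-! ### The choice of the parameters -/

section Robust

variable {K : Type*} [Fintype K]

theorem StreamSketch.isRobustSumSketch_of_lexp_le {b : ℕ} {S : StreamSketch K b} {T : ℕ}
    {Δmin r : ℝ≥0} {ε δ : ℝ} (hδ : 0 ≤ δ)
    (h : ∀ A : StreamAdversary K, (∀ h, ∀ op ∈ (A h).support, StreamOp.InRange Δmin r op) →
      (S.run A T).lexp (fun p => {h | Transcript.PrefixMaxAccurate ε h}ᶜ.indicator 1 p.2) ≤
        ENNReal.ofReal δ) :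
    S.IsRobustSumSketch T Δmin r ε δ := by
  intro A hA
  have h1 := h A hA
  have h2 : (S.run A T).toOuterMeasure {p | Transcript.PrefixMaxAccurate ε p.2} +
      (S.run A T).lexp (fun p => {h | Transcript.PrefixMaxAccurate ε h}ᶜ.indicator 1 p.2) = 1 := by
    rw [PMF.toOuterMeasure_eq_lexp, PMF.lexp, PMF.lexp, ← ENNReal.tsum_add,
      ← (S.run A T).tsum_coe]
    refine tsum_congr fun p => ?_
    by_cases hp : Transcript.PrefixMaxAccurate ε p.2 <;> simp [hp]
  rw [ENNReal.ofReal_sub _ hδ, ENNReal.ofReal_one, tsub_le_iff_right, ← h2]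
  gcongr

/-- For `ε ≥ 1` the estimate `0` is accurate. -/
theorem exists_robustSumSketch_of_one_le {T : ℕ} {Δmin r : ℝ≥0} {ε δ : ℝ} (hε : 1 ≤ ε)
    (hδ : 0 < δ) : ∃ S : StreamSketch K 0, S.IsRobustSumSketch T Δmin r ε δ := by
  let S : StreamSketch K 0 := machineSketch (σ := Unit) (Ω := Unit) (fun _ => Fin.elim0)
    (fun _ _ _ => ()) () (fun _ => 0) (PMF.pure ())
  refine ⟨S, StreamSketch.isRobustSumSketch_of_lexp_le hδ.le fun A _ => ?_⟩
  rw [lexp_run_machineSketch (fun _ _ _ => rfl)]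
  refine le_trans (le_of_eq ?_) zero_le
  refine ENNReal.tsum_eq_zero.2 fun c => ENNReal.tsum_eq_zero.2 fun o => ?_
  rw [Set.indicator_of_notMem, mul_zero, mul_zero]
  rw [Set.notMem_compl_iff]
  refine prefixMaxAccurate_transcriptOf _ _ _ fun t _ M hM => ?_
  have h1 := hM t le_rfl
  have h2 : (0 : ℝ) ≤ StreamOp.sumStat ((List.range (t + 1)).map (extendFin o)) :=
    NNReal.zero_le_coe
  rw [zero_sub, abs_neg, abs_of_nonneg h2]
  nlinarith

theorem unitSum_le {U T : ℕ} (u : StreamOp K → ℕ) (o : ℕ → StreamOp K) {t : ℕ} (ht : t < T)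
    (hU : ∀ i < T, u (o i) ≤ U) : unitSum u o t ≤ T * U := by
  rw [← card_liveUnits u o ht hU]
  refine (Finset.card_le_univ _).trans (by simp)

theorem memory_card_le {T n J B cap c k : ℕ} (hT : T < 2 ^ n) (hk : k ≤ T ^ c)
    (hcap : n * cap ≤ B) :
    (T + 1) * (2 * (((2 * cap + 1) ^ n) ^ J * ((k + 1) ^ (B + n * cap) + 1) ^ J)) ≤
      2 ^ (n + 1 + 2 * B * J + ((n * c + 1) * (2 * B) + 1) * J) := by
  have h1 : ((2 * cap + 1) ^ n) ^ J ≤ 2 ^ (2 * B * J) := by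
    calc ((2 * cap + 1) ^ n) ^ J ≤ ((2 ^ (2 * cap)) ^ n) ^ J := by
          gcongr
          exact Nat.lt_two_pow_self
      _ = 2 ^ (2 * (n * cap) * J) := by
          rw [← pow_mul, ← pow_mul]
          congr 1
          ring
      _ ≤ _ := by
          gcongr
          norm_num
  have h2 : (k + 1) ^ (B + n * cap) ≤ 2 ^ ((n * c + 1) * (2 * B)) := by
    have h3 : k + 1 ≤ 2 ^ (n * c + 1) := by
      have h4 : T ^ c ≤ 2 ^ (n * c) := by
        rw [pow_mul]
        gcongr
      have h5 : 1 ≤ 2 ^ (n * c) := Nat.one_le_two_pow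
      rw [pow_succ]
      omega
    calc (k + 1) ^ (B + n * cap) ≤ (2 ^ (n * c + 1)) ^ (B + n * cap) := by gcongr
      _ ≤ (2 ^ (n * c + 1)) ^ (2 * B) := by
          gcongr
          · exact Nat.one_le_two_pow
          · omega
      _ = _ := by rw [← pow_mul]
  have h3 : ((k + 1) ^ (B + n * cap) + 1) ^ J ≤ 2 ^ (((n * c + 1) * (2 * B) + 1) * J) := by
    rw [pow_mul]
    gcongr
    rw [pow_succ]
    have h5 : 1 ≤ 2 ^ ((n * c + 1) * (2 * B)) := Nat.one_le_two_pow
    omega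
  calc _ ≤ 2 ^ n * (2 * (2 ^ (2 * B * J) * 2 ^ (((n * c + 1) * (2 * B) + 1) * J))) := by
        gcongr
        omega
    _ = _ := by ring

/-- The sketch is robust for any parameters with enough noise and large enough samples: `n` dyadic
lengths, `J` scales, noise terms of at most `cap`, and sample sizes up to `B`. The accuracy
`ε = 240 * s` corresponds to samples that are accurate up to a factor `1 ± 10 * s` and are revealed
with privacy loss `s`. -/
theorem exists_robustSumSketch {T c n J B cap : ℕ} {s δ : ℝ} (hs0 : 0 < s)
    (hs1 : 240 * s ≤ 1) (hδ : 0 < δ) (hK : Fintype.card K ≤ T ^ c) {Δmin : ℝ≥0} (hΔ : 0 < Δmin)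
    (hn : 0 < n) (hT : T < 2 ^ n) (hJ : 4 * T ^ (c + 1) ≤ 2 ^ J) (hB : 1 ≤ 240 * s * B)
    (hcap : n * cap ≤ 10 * s * B)
    (hnoise : (T * J * n : ℕ) * (2 * Real.exp (-(s / (2 * n) * cap))) ≤ δ / 2)
    (hsample : (T * J : ℕ) * (2 * Real.exp (-(5 * s ^ 2 * B))) ≤ δ / 2) :
    ∃ S : StreamSketch K (n + 1 + 2 * B * J + ((n * c + 1) * (2 * B) + 1) * J),
      S.IsRobustSumSketch T Δmin ((T : ℝ≥0) ^ c) (240 * s) δ := by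
  have hB0 : 0 < B := by
    rcases Nat.eq_zero_or_pos B with h | h
    · subst h
      norm_num at hB
    · exact h
  have hBr : (0 : ℝ) < B := by exact_mod_cast hB0
  have hnr : (0 : ℝ) < n := by exact_mod_cast hn
  have hncap : n * cap ≤ B := by
    have : (n * cap : ℝ) ≤ B := hcap.trans (by nlinarith)
    exact_mod_cast this
  obtain ⟨enc, henc⟩ := SketchState.exists_encoding (K := K) (memory_card_le (J := J) hT hK hncap)
  set η := s / (2 * n) with hη
  have hη0 : 0 < η := by positivity
  set a : ℝ≥0∞ := ENNReal.ofReal (Real.exp (-η)) with ha_def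
  have ha : a < 1 := by
    rw [ha_def, ENNReal.ofReal_lt_one, Real.exp_lt_one_iff]
    linarith
  have hapow : ∀ m : ℕ, a ^ m = ENNReal.ofReal (Real.exp (-(η * m))) := by
    intro m
    rw [ha_def, ← ENNReal.ofReal_pow (Real.exp_pos _).le, ← Real.exp_nat_mul]
    congr 2
    ring
  have has : a ^ (2 * n) = ENNReal.ofReal (Real.exp (-s)) := by
    rw [hapow, hη]
    congr 3
    push_cast
    field_simp
  let U := T ^ c * (2 * B)
  let u : StreamOp K → ℕ := StreamOp.units Δmin (2 * B)
  let unit : ℝ := Δmin / (2 * B : ℕ)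
  have hu : ∀ op, StreamOp.InRange Δmin ((T : ℝ≥0) ^ c) op → u op ≤ U := fun op hop =>
    StreamOp.units_le hΔ (2 * B) U (by simp only [U]; push_cast; rfl) hop
  have : Nonempty (SketchState K J n T B cap) := ⟨SketchState.start K J n T B cap⟩
  refine ⟨machineSketch enc (SketchState.next u) (SketchState.start K J n T B cap)
    (SketchState.estimate unit) (coinLaw J U n ha),
    StreamSketch.isRobustSumSketch_of_lexp_le hδ.le fun A hA => ?_⟩
  refine (lexp_failure_le henc A u unit hs0 (by linarith) ha has hT _ hA hu _ ?_).trans ?_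
  · intro o w ho hw hdev
    refine prefixMaxAccurate_transcriptOf _ _ _ fun t ht M hM => ?_
    rw [show 240 * s = 24 * (10 * s) by ring]
    refine abs_observedEstimate_sub_le hΔ hB0 (N := sampleSize u o w) (by linarith) (by linarith)
      (by linarith) (fun i hi => ho i (by omega)) (fun j i hi => ?_) (fun j i hi => ?_) ?_ hM
    · rw [noisySize]
      push_cast
      rw [add_sub_cancel_left]
      refine le_trans ?_ hcap
      have h1 : |noiseSum w j i| ≤ n * cap := by
        refine (Finset.abs_sum_le_sum_abs _ _).trans ?_
        calc _ ≤ ∑ _l : Fin n, (cap : ℤ) := Finset.sum_le_sum fun l _ =>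
              hw _ ((Nat.div_mul_le_self _ _).trans_lt (by omega)) j l
          _ = _ := by simp
      exact_mod_cast h1
    · exact not_lt.1 (hdev i (by omega) j)
    · have hJ0 : 0 < J := by
        rcases Nat.eq_zero_or_pos J with h | h
        · subst h
          have : 0 < T ^ (c + 1) := pow_pos (by omega) _
          simp only [pow_zero] at hJ
          omega
        · exact h
      refine ⟨⟨J - 1, by omega⟩, fun i hi => ?_⟩
      have h1 : (unitSum u o i : ℝ) ≤ (T * (T ^ c * (2 * B)) : ℕ) := by
        exact_mod_cast unitSum_le u o (show i < T by omega) fun k hk => hu _ (ho k hk)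
      have h2 : (4 * T ^ (c + 1) : ℝ) ≤ 2 ^ J := by exact_mod_cast hJ
      simp only [scaleProb]
      rw [Nat.sub_add_cancel hJ0, one_div_mul_eq_div, div_le_iff₀ (by positivity)]
      push_cast at h1
      calc (unitSum u o i : ℝ) ≤ T * (T ^ c * (2 * B)) := h1
        _ = B / 2 * (4 * T ^ (c + 1)) := by ring
        _ ≤ _ := by gcongr
  · rw [hapow, ← ENNReal.ofReal_natCast, ← ENNReal.ofReal_natCast,
      show (2 : ℝ≥0∞) = ENNReal.ofReal 2 by simp, ← ENNReal.ofReal_mul (by norm_num),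
      ← ENNReal.ofReal_mul (by positivity), ← ENNReal.ofReal_mul (by positivity),
      ← ENNReal.ofReal_add (by positivity) (by positivity)]
    refine ENNReal.ofReal_le_ofReal ?_
    linarith

end Robust

theorem memory_bits_le {n J B : ℕ} (c : ℕ) (hn : 1 ≤ n) (hJ : 1 ≤ J) (hB : 1 ≤ B) :
    n + 1 + 2 * B * J + ((n * c + 1) * (2 * B) + 1) * J ≤ (2 * c + 7) * (n * J * B) := by
  have h1 : n ≤ n * J * B := by
    rw [mul_assoc]
    exact Nat.le_mul_of_pos_right n (Nat.mul_pos hJ hB)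
  have h2 : 1 ≤ n * J * B := hn.trans h1
  have h3 : B * J ≤ n * J * B := by
    rw [mul_assoc, mul_comm B J]
    exact Nat.le_mul_of_pos_left _ hn
  have h4 : J ≤ n * J * B := le_trans (Nat.le_mul_of_pos_left J hB) h3
  have h6 : ((n * c + 1) * (2 * B) + 1) * J = 2 * c * (n * J * B) + 2 * (B * J) + J := by ring
  have h7 : 2 * B * J = 2 * (B * J) := by ring
  have h8 : (2 * c + 7) * (n * J * B) = 2 * c * (n * J * B) + 7 * (n * J * B) := by ring
  omega

theorem bits_le_budget {n J B c : ℕ} {L D ε : ℝ} (hL : 1 / 2 ≤ L) (hD : 1 / 2 ≤ D) (hnL : n ≤ 3 * L)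
    (hJn : J ≤ (n : ℝ) * (c + 3))
    (hB : B ≤ 18 * (4 * c + 36) * 240 ^ 2 * (L ^ 3 * D / ε ^ 2)) :
    (2 * c + 7) * (n * J * B : ℝ) ≤
      4 * ((2 * c + 7) * (9 * (c + 3)) * (18 * (4 * c + 36)) * 240 ^ 2) *
      (1 / ε ^ 2 * L ^ (11 / 2 : ℝ) * D ^ 2) := by
  have hL0 : 0 < L := by linarith
  have hD0 : 0 < D := by linarith
  have hJL : (J : ℝ) ≤ 3 * L * (c + 3) := hJn.trans (by gcongr)
  have hpow : L ^ 5 ≤ 2 * L ^ (11 / 2 : ℝ) := by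
    have h1 : L ^ (11 / 2 : ℝ) = L ^ 5 * L ^ (1 / 2 : ℝ) := by
      rw [← Real.rpow_natCast L 5, ← Real.rpow_add hL0]
      norm_num
    have h2 : (1 / 2 : ℝ) ≤ L ^ (1 / 2 : ℝ) := by
      rw [← Real.sqrt_eq_rpow]
      refine Real.le_sqrt_of_sq_le ?_
      linarith
    rw [h1]
    nlinarith [pow_pos hL0 5]
  have hDsq : D ≤ 2 * D ^ 2 := by nlinarith
  calc (2 * c + 7 : ℝ) * (n * J * B) ≤ (2 * c + 7 : ℝ) * ((3 * L) * (3 * L * (c + 3)) *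
        (18 * (4 * c + 36) * 240 ^ 2 * (L ^ 3 * D / ε ^ 2))) := by gcongr
    _ = (2 * c + 7) * (9 * (c + 3)) * (18 * (4 * c + 36)) * 240 ^ 2 * (1 / ε ^ 2 * L ^ 5 * D) := by
        ring
    _ ≤ (2 * c + 7) * (9 * (c + 3)) * (18 * (4 * c + 36)) * 240 ^ 2 *
        (1 / ε ^ 2 * (2 * L ^ (11 / 2 : ℝ)) * (2 * D ^ 2)) := by gcongr
    _ = _ := by ring

/-- The logarithm of the number of bad events over `δ`, one for each time, scale and dyadic length,
is of order `log T * log (1 / δ)`. -/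
theorem log_bad_events_le {T n J c : ℕ} (hT : 2 ≤ T) {δ : ℝ} (hδ : 0 < δ) (hδ2 : δ ≤ 1 / 2)
    (hn : 1 ≤ n) (hJ : 1 ≤ J) (hnT : n ≤ T) (hJn : J ≤ (n : ℝ) * (c + 3)) :
    Real.log (4 * (T * J * n) / δ) + 1 ≤
      (4 * c + 36) * (Real.log T * Real.log (1 / δ)) := by
  have hTr : (2 : ℝ) ≤ T := by exact_mod_cast hT
  have hn1 : (0 : ℝ) < n := by exact_mod_cast hn
  have hJr : (0 : ℝ) < J := by exact_mod_cast hJ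
  have hlog2 : (1 / 2 : ℝ) ≤ Real.log 2 := by linarith [Real.log_two_gt_d9]
  obtain ⟨L, hL⟩ : ∃ L, L = Real.log T := ⟨_, rfl⟩
  obtain ⟨D, hD⟩ : ∃ D, D = Real.log (1 / δ) := ⟨_, rfl⟩
  rw [← hL, ← hD]
  have hL2 : Real.log 2 ≤ L := hL ▸ Real.log_le_log (by norm_num) hTr
  have hD2 : Real.log 2 ≤ D := by
    rw [hD]
    refine Real.log_le_log (by norm_num) ?_
    rw [le_div_iff₀ hδ]
    linarith
  have h1 : Real.log (4 * (T * J * n) / δ) ≤ Real.log (4 * (T * (T * (c + 3)) * T) * (1 / δ)) := by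
    rw [mul_one_div]
    refine Real.log_le_log (by positivity) ?_
    have h2 : (n : ℝ) ≤ T := by exact_mod_cast hnT
    gcongr
    exact hJn.trans (by gcongr)
  have h2 : Real.log (4 * (T * (T * (c + 3)) * T) * (1 / δ)) =
      Real.log 4 + 3 * L + Real.log (c + 3) + D := by
    rw [Real.log_mul (by positivity) (by positivity), Real.log_mul (by norm_num) (by positivity),
      Real.log_mul (by positivity) (by positivity), Real.log_mul (by positivity) (by positivity),
      Real.log_mul (by positivity) (by positivity)]
    rw [hL, hD]
    ring
  have h3 : Real.log 4 ≤ 3 := by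
    linarith [Real.log_le_sub_one_of_pos (show (0 : ℝ) < 4 by norm_num)]
  have h4 : Real.log (c + 3) ≤ c + 3 := by
    linarith [Real.log_le_sub_one_of_pos (show (0 : ℝ) < c + 3 by positivity)]
  have h5 : 1 / 2 ≤ L := by linarith
  have h6 : 1 / 2 ≤ D := by linarith
  have h7 : (1 : ℝ) ≤ 4 * (L * D) := by nlinarith
  have h8 : L ≤ 2 * (L * D) := by nlinarith
  have h9 : D ≤ 2 * (L * D) := by nlinarith
  have h10 : (c + 7 : ℝ) ≤ (c + 7) * (4 * (L * D)) := le_mul_of_one_le_right (by positivity) h7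
  linarith

/-- Numbers of dyadic lengths `n` and of scales `J`, a sample size `B` and a noise bound `cap` that
meet the requirements of the sketch. The sample size is of order `n ^ 2 * Λ / ε ^ 2`, where `Λ` is
the logarithm of the number of bad events over `δ`: the noise is of order `n / ε` for each of the
`n` lengths, up to the factor `Λ`, and it has to be at most `ε * B`. -/
theorem exists_parameters {T c : ℕ} (hT : 2 ≤ T) {ε δ : ℝ} (hε : 0 < ε) (hε1 : ε < 1) (hδ : 0 < δ)
    (hδ2 : δ ≤ 1 / 2) :
    ∃ n J B cap : ℕ, 0 < n ∧ T < 2 ^ n ∧ 4 * T ^ (c + 1) ≤ 2 ^ J ∧ 1 ≤ 240 * (ε / 240) * B ∧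
      n * cap ≤ 10 * (ε / 240) * B ∧
      (T * J * n : ℕ) * (2 * Real.exp (-(ε / 240 / (2 * n) * cap))) ≤ δ / 2 ∧
      (T * J : ℕ) * (2 * Real.exp (-(5 * (ε / 240) ^ 2 * B))) ≤ δ / 2 ∧
      ((n + 1 + 2 * B * J + ((n * c + 1) * (2 * B) + 1) * J : ℕ) : ℝ) ≤
        4 * ((2 * c + 7) * (9 * (c + 3)) * (18 * (4 * c + 36)) * 240 ^ 2) *
          (1 / ε ^ 2 * Real.log T ^ (11 / 2 : ℝ) * Real.log (1 / δ) ^ 2) := by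
  have hTr : (2 : ℝ) ≤ T := by exact_mod_cast hT
  have hlog2 : (1 / 2 : ℝ) ≤ Real.log 2 := by linarith [Real.log_two_gt_d9]
  obtain ⟨L, hL⟩ : ∃ L, L = Real.log T := ⟨_, rfl⟩
  obtain ⟨D, hD⟩ : ∃ D, D = Real.log (1 / δ) := ⟨_, rfl⟩
  rw [← hL, ← hD]
  have hL2 : Real.log 2 ≤ L := hL ▸ Real.log_le_log (by norm_num) hTr
  have hD2 : Real.log 2 ≤ D := by
    rw [hD]
    refine Real.log_le_log (by norm_num) ?_
    rw [le_div_iff₀ hδ]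
    linarith
  have hL0 : 0 < L := by linarith
  have hD0 : 0 < D := by linarith
  obtain ⟨s, hs⟩ : ∃ s, s = ε / 240 := ⟨_, rfl⟩
  rw [← hs]
  have hs0 : 0 < s := by rw [hs]; positivity
  have hs1 : s < 1 := by linarith
  obtain ⟨n, hn⟩ : ∃ n, n = Nat.log 2 T + 1 := ⟨_, rfl⟩
  have hTn : T < 2 ^ n := hn ▸ Nat.lt_pow_succ_log_self (by norm_num) T
  have hnT : n ≤ T := by
    calc n ≤ 2 ^ Nat.log 2 T := hn ▸ Nat.lt_two_pow_self
      _ ≤ T := Nat.pow_log_le_self 2 (by omega)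
  have hn1 : (1 : ℝ) ≤ n := by
    have : 1 ≤ n := by omega
    exact_mod_cast this
  have hnL : (n : ℝ) ≤ 3 * L := by
    have h1 : (Nat.log 2 T : ℝ) * Real.log 2 ≤ L := by
      rw [← Real.log_pow, hL]
      refine Real.log_le_log (by positivity) ?_
      exact_mod_cast Nat.pow_log_le_self 2 (by omega)
    have h2 := Real.log_two_gt_d9
    rw [hn]
    push_cast
    nlinarith
  obtain ⟨J, hJ⟩ : ∃ J, J = n * (c + 1) + 2 := ⟨_, rfl⟩
  have hJ1 : 1 ≤ J := by omega
  have hJn : (J : ℝ) ≤ n * (c + 3) := by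
    rw [hJ]
    push_cast
    nlinarith
  have hJr : (1 : ℝ) ≤ J := by exact_mod_cast hJ1
  have hTJ : 4 * T ^ (c + 1) ≤ 2 ^ J := by
    calc 4 * T ^ (c + 1) ≤ 4 * (2 ^ n) ^ (c + 1) := by gcongr
      _ = 2 ^ J := by rw [hJ]; ring
  obtain ⟨Λ, hΛ⟩ : ∃ Λ, Λ = Real.log (4 * (T * J * n) / δ) := ⟨_, rfl⟩
  have hTJn : (1 : ℝ) ≤ T * J * n :=
    one_le_mul_of_one_le_of_one_le (one_le_mul_of_one_le_of_one_le (by linarith) hJr) hn1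
  have hΛ0 : 0 ≤ Λ := by
    rw [hΛ]
    refine Real.log_nonneg ?_
    rw [le_div_iff₀ hδ]
    linarith
  have hΛle : Λ + 1 ≤ (4 * c + 36) * (L * D) := by
    rw [hΛ, hL, hD]
    exact log_bad_events_le hT hδ hδ2 (by omega) hJ1 hnT hJn
  obtain ⟨cap, hcap1, hcap2⟩ : ∃ cap : ℕ, 2 * n / s * Λ ≤ cap ∧ (cap : ℝ) ≤ 2 * n / s * Λ + 1 :=
    ⟨⌈2 * n / s * Λ⌉₊, Nat.le_ceil _, (Nat.ceil_lt_add_one (by positivity)).le⟩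
  have hsq : s ^ 2 ≤ s := by
    rw [sq]
    exact mul_le_of_le_one_left hs0.le hs1.le
  have hone : 1 ≤ (n : ℝ) ^ 2 := one_le_pow₀ hn1
  have hone' : 1 ≤ (n : ℝ) ^ 2 * (Λ + 1) := one_le_mul_of_one_le_of_one_le hone (by linarith)
  have hBone : 1 ≤ (n : ℝ) ^ 2 * (Λ + 1) / s ^ 2 := by
    rw [le_div_iff₀ (by positivity)]
    linarith
  obtain ⟨B, hB1, hB2⟩ : ∃ B : ℕ, (n : ℝ) ^ 2 * (Λ + 1) / s ^ 2 ≤ B ∧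
      (B : ℝ) ≤ 2 * ((n : ℝ) ^ 2 * (Λ + 1) / s ^ 2) :=
    ⟨⌈(n : ℝ) ^ 2 * (Λ + 1) / s ^ 2⌉₊, Nat.le_ceil _, by
      linarith [(Nat.ceil_lt_add_one (zero_le_one.trans hBone)).le]⟩
  have hB1' : (n : ℝ) ^ 2 * (Λ + 1) ≤ B * s ^ 2 := (div_le_iff₀ (by positivity)).1 hB1
  have hBr : (1 : ℝ) ≤ B := hBone.trans hB1
  have hexpΛ : Real.exp (-Λ) = δ / (4 * (T * J * n)) := by
    rw [hΛ, Real.exp_neg, Real.exp_log (by positivity), inv_div]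
  have hc1 : 1 ≤ 240 * s * B := by
    have h1 : (B : ℝ) * s ^ 2 ≤ B * s := by gcongr
    linarith
  have hc2 : n * cap ≤ 10 * s * B := by
    have h1 : (n : ℝ) * cap * s ≤ 10 * s * B * s := by
      have h2 : (n : ℝ) * cap * s ≤ n * (2 * n / s * Λ + 1) * s := by gcongr
      have h3 : (n : ℝ) * (2 * n / s * Λ + 1) * s = 2 * (n ^ 2 * Λ) + n * s := by
        field_simp
      have h4 : (n : ℝ) * s ≤ n ^ 2 := by
        rw [sq]
        gcongr
        linarith
      have h5 : 0 ≤ (n : ℝ) ^ 2 * Λ := by positivity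
      have h6 : 10 * s * B * s = 10 * (B * s ^ 2) := by ring
      linarith
    exact le_of_mul_le_mul_right h1 hs0
  have hc3 : (T * J * n : ℕ) * (2 * Real.exp (-(s / (2 * n) * cap))) ≤ δ / 2 := by
    have h1 : Real.exp (-(s / (2 * n) * cap)) ≤ Real.exp (-Λ) := by
      refine Real.exp_le_exp.2 (neg_le_neg ?_)
      calc Λ = s / (2 * n) * (2 * n / s * Λ) := by field_simp
        _ ≤ _ := by gcongr
    rw [hexpΛ] at h1
    push_cast
    calc (T * J * n : ℝ) * (2 * Real.exp (-(s / (2 * n) * cap)))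
        ≤ T * J * n * (2 * (δ / (4 * (T * J * n)))) := by gcongr
      _ = δ / 2 := by field_simp; norm_num
  have hc4 : (T * J : ℕ) * (2 * Real.exp (-(5 * s ^ 2 * B))) ≤ δ / 2 := by
    have h1 : Real.exp (-(5 * s ^ 2 * B)) ≤ Real.exp (-Λ) := by
      refine Real.exp_le_exp.2 (neg_le_neg ?_)
      have h2 : Λ + 1 ≤ n ^ 2 * (Λ + 1) := le_mul_of_one_le_left (by linarith) hone
      have h3 : 5 * s ^ 2 * B = 5 * (B * s ^ 2) := by ring
      linarith
    rw [hexpΛ] at h1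
    push_cast
    calc (T * J : ℝ) * (2 * Real.exp (-(5 * s ^ 2 * B)))
        ≤ T * J * n * (2 * (δ / (4 * (T * J * n)))) := by
          refine mul_le_mul (le_mul_of_one_le_right (by positivity) hn1) ?_ (by positivity)
            (by positivity)
          gcongr
      _ = δ / 2 := by field_simp; norm_num
  have hBfin : (B : ℝ) ≤ 18 * (4 * c + 36) * 240 ^ 2 * (L ^ 3 * D / ε ^ 2) := by
    have h1 : (n : ℝ) ^ 2 ≤ (3 * L) ^ 2 := by gcongr
    calc (B : ℝ) ≤ 2 * ((n : ℝ) ^ 2 * (Λ + 1) / s ^ 2) := hB2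
      _ ≤ 2 * ((3 * L) ^ 2 * ((4 * c + 36) * (L * D)) / s ^ 2) := by gcongr
      _ = _ := by rw [hs]; field_simp; ring
  have hbits : ((n + 1 + 2 * B * J + ((n * c + 1) * (2 * B) + 1) * J : ℕ) : ℝ) ≤
      (2 * c + 7) * (n * J * B) := by
    exact_mod_cast memory_bits_le c (by omega) hJ1 (by exact_mod_cast hBr)
  exact ⟨n, J, B, cap, by omega, hTn, hTJ, hc1, hc2, hc3, hc4,
    hbits.trans (bits_le_budget (by linarith) (by linarith) hnL hJn hBfin)⟩

theorem mainTheorem2 (c : ℕ) :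
    ∃ C : ℝ, 0 < C ∧
      ∀ (T : ℕ), 2 ≤ T → ∀ (ε δ : ℝ), 0 < ε → 0 < δ → δ ≤ 1 / 2 →
      ∀ (K : Type*) [Fintype K], Fintype.card K ≤ T ^ c →
      ∀ (Δmin : ℝ≥0), 0 < Δmin →
        ∃ (b : ℕ) (S : StreamSketch K b),
          (b : ℝ) ≤ C * (1 / ε ^ 2 * Real.log T ^ (11 / 2 : ℝ) * Real.log (1 / δ) ^ 2) ∧
          S.IsRobustSumSketch T Δmin ((T : ℝ≥0) ^ c) ε δ := by
  refine ⟨4 * ((2 * c + 7) * (9 * (c + 3)) * (18 * (4 * c + 36)) * 240 ^ 2), by positivity, ?_⟩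
  intro T hT ε δ hε hδ hδ2 K _ hK Δmin hΔ
  rcases le_or_gt 1 ε with hε1 | hε1
  · obtain ⟨S, hS⟩ := exists_robustSumSketch_of_one_le (K := K) (T := T) (Δmin := Δmin)
      (r := (T : ℝ≥0) ^ c) hε1 hδ
    refine ⟨0, S, ?_, hS⟩
    rw [Nat.cast_zero]
    have : 0 ≤ Real.log T := Real.log_natCast_nonneg T
    positivity
  obtain ⟨n, J, B, cap, hn, hTn, hTJ, hB, hcap, hnoise, hsample, hb⟩ :=
    exists_parameters (c := c) hT hε hε1 hδ hδ2
  obtain ⟨S, hS⟩ := exists_robustSumSketch (by positivity) (by linarith) hδ hK hΔ hn hTn hTJ hB hcap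
    hnoise hsample
  rw [show 240 * (ε / 240) = ε by ring] at hS
  exact ⟨_, S, hb, hS⟩
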